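/- Let $N\ge 0$ and $n=N+1$. Number the qubits $1,\dots,n$. For an $n$-qubit density matrix $\rho$ let $F_{1k}(\rho)=\langle\psi^-|\rho_{1k}|\psi^-\rangle$, $k=2,\dots,n$, where $\rho_{1k}$ is the reduced state of qubits $1$ and $k$ and $|\psi^-\rangle=\tfrac1{\sqrt2}(|01\rangle-|10\rangle)$. The allowed region of fidelities $\mathcal F\subset\mathbb R^N$ is the set of all vectors $(F_{12}(\rho),\dots,F_{1n}(\rho))$, where $\rho$ runs over the $n$-qubit states whose first qubit is maximally mixed, $\rho_1=I/2$ (these states correspond to the $1\to N$ cloning machines). For a partition $\lambda\vdash n$ let $d_\lambda$ be the number of standard Young tableaux of shape $\lambda$, and let $\widetilde V^\lambda_{(1k)}$ be the $d_\lambda\times d_\lambda$ matrix of the transposition $(1k)$ in the irreducible representation $\lambda$ of $S_n$ given in Young's orthogonal form, i.e. the product $(s_1\cdots s_{k-2})\,s_{k-1}\,(s_{k-2}\cdots s_1)$ of the matrices of the adjacent transpositions $s_i=(i\;i{+}1)$, where $s_iT=\tfrac1r T+\sqrt{1-\tfrac1{r^2}}\;T'$; here $T'$ is $T$ with $i$ and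 $i+1$ exchanged (the second term being absent if $T'$ is not standard), and $r$ is the content (column minus row) of the cell of $i+1$ minus that of the cell of $i$ in $T$. For a unit vector $\psi\in\mathbb C^{d_\lambda}$ put $F^\lambda_{1k}(\psi)=\tfrac12-\tfrac12\langle\psi|\widetilde V^\lambda_{(1k)}|\psi\rangle$. Let $\mathcal F^\lambda$ be the set of the vectors $(F^\lambda_{12}(\psi),\dots,F^\lambda_{1n}(\psi))$ over all unit $\psi\in\mathbb C^{d_\lambda}$, and let $\mathcal F^\lambda_{\mathbb R}$ be the same set with $\psi$ restricted to unit vectors with real coefficients. Then: (1) for every $\lambda\vdash n$ and every $k$ the matrix $\widetilde V^\lambda_{(1k)}$ is real and symmetric; (2) for every $\lambda\vdash n$ and every unit $\psi\in\mathbb C^{d_\lambda}$, with $R=\operatorname{Re}(\psi\psi^\dagger)$ (entrywise real part), one has $\langle\psi|\widetilde V^\lambda_{(1k)}|\psi\rangle=\operatorname{tr}(R\,\widetilde V^\lambda_{(1k)})$ for all $k$, the matrix $R$ is positive semidefinite, and $R$ is a convex combination of matrices $\varphi\varphi^{T}$ with $\varphi\in\mathbb R^{d_\lambda}$ a unit vector;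 (3) $\operatorname{conv}\mathcal F^\lambda=\operatorname{conv}\mathcal F^\lambda_{\mathbb R}$ for every $\lambda\vdash n$; (4) the allowed region is generated by real pure states of the irreducible blocks: $$\mathcal F=\operatorname{conv}\Big(\bigcup_{\lambda\vdash n,\ \lambda\text{ with at most two rows}}\mathcal F^\lambda_{\mathbb R}\Big).$$ -/

import Mathlib

open scoped Matrix ComplexOrder

namespace QubitCloning

/-! ### Young's orthogonal form of the irreducible representations of the symmetric group -/

/-- Standard Young tableaux of shape `μ` with `n` entries: a tableau is the bijection sending each
entry to the cell containing it, and the entries increase along rows and down columns.  (Cells are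
pairs `(row, column)`.  The entries `1, …, n` are written `0, …, n - 1`.) -/
abbrev StdTableau (n : ℕ) (μ : YoungDiagram) : Type :=
  {T : Fin n ≃ μ.cells // ∀ i j : Fin n, (T i : ℕ × ℕ) ≤ (T j : ℕ × ℕ) → i ≤ j}

/-- The content `column - row` of a cell. -/
def content (c : ℕ × ℕ) : ℤ := (c.2 : ℤ) - (c.1 : ℤ)

/-- The axial distance in `T` between the `i`-th entry and the next one, as a difference of
contents.  It is never `0` in a standard tableau. -/
def axialDist {N : ℕ} {μ : YoungDiagram} (T : StdTableau (N + 1) μ) (i : Fin N) : ℤ :=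
  content (T.1 i.succ) - content (T.1 i.castSucc)

/-- The matrix, in Young's orthogonal form, of the adjacent transposition `sᵢ` exchanging entry `i`
with the next one.  On the basis vector `T` with axial distance `r` it acts by
`sᵢ T = (1 / r) T + √(1 - 1 / r²) (sᵢ · T)`, where `sᵢ · T` is obtained from `T` by exchanging the
two entries; the second term is absent if `sᵢ · T` is not standard. -/
noncomputable def youngAdj {N : ℕ} (μ : YoungDiagram) (i : Fin N) :
    Matrix (StdTableau (N + 1) μ) (StdTableau (N + 1) μ) ℝ :=
  fun S T =>
    if S = T then 1 / (axialDist T i : ℝ)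
    else if S.1 = (Equiv.swap i.castSucc i.succ).trans T.1 then
      Real.sqrt (1 - 1 / (axialDist T i : ℝ) ^ 2)
    else 0

/-- The matrix representing the transposition that exchanges the first system (index `0`) with the
clone `k` (index `k.succ`), written in adjacent transpositions as
`(s₀ s₁ ⋯ sₖ₋₁) sₖ (sₖ₋₁ ⋯ s₁ s₀)`. -/
noncomputable def swapMatrix {N : ℕ} (μ : YoungDiagram) (k : Fin N) :
    Matrix (StdTableau (N + 1) μ) (StdTableau (N + 1) μ) ℝ :=
  let w : List (Fin N) := (List.finRange N).take (k : ℕ)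
  (w.map (youngAdj μ)).prod * youngAdj μ k * (w.reverse.map (youngAdj μ)).prod

/-- The vector of fidelities `1/2 - ⟨ψ| V |ψ⟩ / 2` produced by a vector `ψ` in the block `μ`. -/
noncomputable def blockFidelity {N : ℕ} (μ : YoungDiagram) (ψ : StdTableau (N + 1) μ → ℂ) :
    Fin N → ℝ :=
  fun k => 1 / 2 - 1 / 2 * (star ψ ⬝ᵥ ((swapMatrix μ k).map Complex.ofReal *ᵥ ψ)).re

/-- Fidelity vectors produced by all (complex) pure states of the block `μ`. -/
def blockRegion (N : ℕ) (μ : YoungDiagram) : Set (Fin N → ℝ) :=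
  {F | ∃ ψ : StdTableau (N + 1) μ → ℂ, ∑ T, ‖ψ T‖ ^ 2 = 1 ∧ F = blockFidelity μ ψ}

/-- Fidelity vectors produced by the pure states of the block `μ` with real coefficients. -/
def realBlockRegion (N : ℕ) (μ : YoungDiagram) : Set (Fin N → ℝ) :=
  {F | ∃ ψ : StdTableau (N + 1) μ → ℂ, ∑ T, ‖ψ T‖ ^ 2 = 1 ∧ (∀ T, (ψ T).im = 0) ∧
    F = blockFidelity μ ψ}

/-- The entrywise real part of the density matrix `|ψ⟩⟨ψ|`. -/
def realPart {ι : Type*} (ψ : ι → ℂ) : Matrix ι ι ℝ :=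
  (Matrix.vecMulVec ψ (star ψ)).map Complex.re

/-- The density matrices of real pure states. -/
def realPureStates (ι : Type*) [Fintype ι] : Set (Matrix ι ι ℝ) :=
  {P | ∃ φ : ι → ℝ, ∑ i, φ i ^ 2 = 1 ∧ P = Matrix.vecMulVec φ φ}

/-! ### The allowed region of fidelities -/

/-- The reduced matrix of an `n`-qubit matrix `ρ` on the subsystems listed (without repetition) by
`e`: partial trace over all other subsystems. -/
noncomputable def reduced {n m : ℕ} (e : Fin m → Fin n)
    (ρ : Matrix (Fin n → Fin 2) (Fin n → Fin 2) ℂ) :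
    Matrix (Fin m → Fin 2) (Fin m → Fin 2) ℂ :=
  open scoped Classical in
  fun a b => ∑ x, ∑ y,
    if (∀ i, x (e i) = a i) ∧ (∀ i, y (e i) = b i) ∧ (∀ j, j ∉ Set.range e → x j = y j)
    then ρ x y else 0

/-- The two-qubit singlet vector `(|01⟩ - |10⟩) / √2`. -/
noncomputable def singlet : (Fin 2 → Fin 2) → ℂ :=
  fun a => if a = ![0, 1] then ((1 / Real.sqrt 2 : ℝ) : ℂ)
    else if a = ![1, 0] then -((1 / Real.sqrt 2 : ℝ) : ℂ) else 0

/-- The singlet fraction `⟨ψ⁻| ρ₀ₖ |ψ⁻⟩` of the reduced state of system `0` and the clone `k`. -/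
noncomputable def fidelity {N : ℕ}
    (ρ : Matrix (Fin (N + 1) → Fin 2) (Fin (N + 1) → Fin 2) ℂ) (k : Fin N) : ℝ :=
  (star singlet ⬝ᵥ (reduced ![0, k.succ] ρ *ᵥ singlet)).re

/-- The allowed region: the fidelity vectors of all `(N + 1)`-qubit states whose first subsystem is
maximally mixed (these states correspond to the `1 → N` cloning machines). -/
def allowedRegion (N : ℕ) : Set (Fin N → ℝ) :=
  {F | ∃ ρ : Matrix (Fin (N + 1) → Fin 2) (Fin (N + 1) → Fin 2) ℂ,
    ρ.PosSemidef ∧ ρ.trace = 1 ∧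
    reduced ![0] ρ = (1 / 2 : ℂ) • (1 : Matrix (Fin 1 → Fin 2) (Fin 1 → Fin 2) ℂ) ∧
    F = fidelity ρ}

end QubitCloning

/-!
The singlet projector of two qubits is `(1 - V) / 2`, where `V` exchanges them, so the fidelities of
a state are expectations of the transpositions `(0 k)` acting on the tensor power of `ℂ²`
(`fidelity_eq`). Schur–Weyl duality splits this representation of the symmetric group into the
blocks of the two-row diagrams, and everything else is convexity: a state is a mixture of pure
states, a pure state has components in the blocks, and, as the block matrices are real and
symmetric (`swapMatrix_isSymm`), the real and the imaginary part of each component contribute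
separately. The sums are kept track of by `blockForm`, a homogeneous version of the fidelity vector
(`sum_blockForm_mem_convexHull`).

The duality is made explicit by the Schur basis. A standard tableau with at most two rows is a
ballot word `p` (the rows of its entries), that is, a path of successive couplings of one more
spin `1/2`; the basis vector of path `p` and with `w` ones has the amplitude `amp p x`, a product of
Clebsch–Gordan coefficients, at each string `x` with `w` ones. Orthonormality
(`sum_weight_amp_mul_amp`) and completeness (`sum_amp_mul_amp`) follow by induction from those of
the coefficients. An adjacent transposition affects only two consecutive factors of the product, and
the resulting identity between Clebsch–Gordan coefficients (`cgTwo_swap_same`,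
`cgTwo_swap_zero_one`, `cgTwo_swap_one_zero`) is exactly Young's orthogonal form
(`amp_comp_swap`, `intertwines_youngAdj`).

Completeness puts every fidelity vector into the convex hull of the block regions
(`fidelity_mem_convexHull`). Conversely, orthonormality embeds each block isometrically into the
vectors with `⌊n / 2⌋` ones; mixing such a vector equally with its image under the flip of all
qubits keeps the fidelities and makes the first qubit maximally mixed (`reduced_flipMixture`).
-/

namespace QubitCloning

/-! ### Real symmetric block matrices and mixtures of real pure states -/

theorem axialDist_of_eq_swap {N : ℕ} {μ : YoungDiagram} {S T : StdTableau (N + 1) μ} {i : Fin N}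
    (h : S.1 = (Equiv.swap i.castSucc i.succ).trans T.1) : axialDist S i = -axialDist T i := by
  simp [axialDist, h]

theorem youngAdj_isSymm {N : ℕ} (μ : YoungDiagram) (i : Fin N) : (youngAdj μ i).IsSymm := by
  ext S T
  rw [Matrix.transpose_apply]
  by_cases h : S = T
  · rw [h]
  have key : ∀ {S T : StdTableau (N + 1) μ},
      S.1 = (Equiv.swap i.castSucc i.succ).trans T.1 →
        T.1 = (Equiv.swap i.castSucc i.succ).trans S.1 := by
    intro S T h
    rw [h]
    ext j : 1
    simp
  by_cases h' : S.1 = (Equiv.swap i.castSucc i.succ).trans T.1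
  · simp only [youngAdj, if_neg h, if_neg (Ne.symm h), if_pos h', if_pos (key h'),
      axialDist_of_eq_swap h']
    simp
  · have h'' : ¬ T.1 = (Equiv.swap i.castSucc i.succ).trans S.1 := fun h => h' (key h)
    simp only [youngAdj, if_neg h, if_neg (Ne.symm h), if_neg h', if_neg h'']

theorem swapMatrix_isSymm {N : ℕ} (μ : YoungDiagram) (k : Fin N) : (swapMatrix μ k).IsSymm := by
  have hT : ∀ w : List (Fin N),
      ((w.map (youngAdj μ)).prod)ᵀ = (w.reverse.map (youngAdj μ)).prod := by
    intro w
    rw [Matrix.transpose_list_prod, List.map_reverse, List.map_map]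
    congr 2
    exact List.map_congr_left fun i _ => youngAdj_isSymm μ i
  unfold swapMatrix Matrix.IsSymm
  simp only [Matrix.transpose_mul, hT, List.reverse_reverse, (youngAdj_isSymm μ k).eq,
    Matrix.mul_assoc]

/-- A finite sum of points `g i = q i • s i`, with nonnegative weights `q i` of total `1` and with
`s i ∈ S` whenever `q i ≠ 0`, lies in the convex hull of `S`. -/
theorem sum_mem_convexHull_of_weights {κ E : Type*} [Fintype κ] [AddCommGroup E] [Module ℝ E]
    {S : Set E} (g : κ → E) (q : κ → ℝ) (hq : ∀ i, 0 ≤ q i) (hsum : ∑ i, q i = 1)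
    (h0 : ∀ i, q i = 0 → g i = 0) (hS : ∀ i, q i ≠ 0 → (q i)⁻¹ • g i ∈ S) :
    ∑ i, g i ∈ convexHull ℝ S := by
  classical
  have h1 : ∑ i, g i = ∑ i ∈ Finset.univ.filter (fun i => q i ≠ 0), q i • ((q i)⁻¹ • g i) := by
    rw [Finset.sum_filter]
    refine Finset.sum_congr rfl fun i _ => ?_
    by_cases h : q i = 0
    · simp [h, h0 i h]
    · simp [h, smul_smul]
  rw [h1]
  refine (convex_convexHull ℝ S).sum_mem (fun i _ => hq i) ?_ fun i hi =>
    subset_convexHull ℝ S (hS i (by simpa using hi))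
  rw [Finset.sum_filter_ne_zero, hsum]

section RealForms

variable {ι : Type*}

theorem realPart_eq (ψ : ι → ℂ) :
    realPart ψ = Matrix.vecMulVec (fun i => (ψ i).re) (fun i => (ψ i).re) +
      Matrix.vecMulVec (fun i => (ψ i).im) (fun i => (ψ i).im) := by
  ext i j
  simp [realPart, Matrix.vecMulVec_apply]

variable [Fintype ι]

theorem inv_smul_vecMulVec_mem_realPureStates (φ : ι → ℝ) (h : ∑ i, φ i ^ 2 ≠ 0) :
    (∑ i, φ i ^ 2)⁻¹ • Matrix.vecMulVec φ φ ∈ realPureStates ι := by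
  have h0 : 0 ≤ ∑ i, φ i ^ 2 := Finset.sum_nonneg fun i _ => sq_nonneg _
  refine ⟨fun i => (Real.sqrt (∑ i, φ i ^ 2))⁻¹ * φ i, ?_, ?_⟩
  · simp only [mul_pow, inv_pow, Real.sq_sqrt h0, ← Finset.mul_sum]
    exact inv_mul_cancel₀ h
  · ext i j
    have : (∑ i, φ i ^ 2)⁻¹ =
        (Real.sqrt (∑ i, φ i ^ 2))⁻¹ * (Real.sqrt (∑ i, φ i ^ 2))⁻¹ := by
      rw [← mul_inv, Real.mul_self_sqrt h0]
    simp only [Matrix.smul_apply, Matrix.vecMulVec_apply, smul_eq_mul]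
    rw [this]
    ring

theorem eq_zero_of_sum_sq_eq_zero {φ : ι → ℝ} (h : ∑ i, φ i ^ 2 = 0) : φ = 0 := by
  funext i
  have := (Finset.sum_eq_zero_iff_of_nonneg fun i _ => sq_nonneg (φ i)).1 h i (Finset.mem_univ i)
  simpa using this

theorem sum_norm_sq_eq (ψ : ι → ℂ) :
    ∑ i, ‖ψ i‖ ^ 2 = ∑ i, (ψ i).re ^ 2 + ∑ i, (ψ i).im ^ 2 := by
  rw [← Finset.sum_add_distrib]
  refine Finset.sum_congr rfl fun i _ => ?_
  rw [Complex.sq_norm, Complex.normSq_apply]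
  ring

theorem realPart_posSemidef (ψ : ι → ℂ) : (realPart ψ).PosSemidef := by
  rw [realPart_eq]
  exact (Matrix.posSemidef_vecMulVec_self_star fun i => (ψ i).re).add
    (Matrix.posSemidef_vecMulVec_self_star fun i => (ψ i).im)

theorem realPart_mem_convexHull (ψ : ι → ℂ) (hψ : ∑ i, ‖ψ i‖ ^ 2 = 1) :
    realPart ψ ∈ convexHull ℝ (realPureStates ι) := by
  let φ : Fin 2 → ι → ℝ := ![fun i => (ψ i).re, fun i => (ψ i).im]
  have h : realPart ψ = ∑ l, Matrix.vecMulVec (φ l) (φ l) := by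
    rw [realPart_eq, Fin.sum_univ_two]
    rfl
  rw [h]
  refine sum_mem_convexHull_of_weights _ (fun l => ∑ i, φ l i ^ 2)
    (fun l => Finset.sum_nonneg fun i _ => sq_nonneg _) ?_ (fun l hl => ?_)
    fun l hl => inv_smul_vecMulVec_mem_realPureStates _ hl
  · rw [Fin.sum_univ_two, ← hψ, sum_norm_sq_eq]
    rfl
  · rw [eq_zero_of_sum_sq_eq_zero hl]
    ext i j
    simp [Matrix.vecMulVec_apply]

/-- For a real symmetric matrix the cross terms between the real and the imaginary part of `ψ`
cancel. -/
theorem star_dotProduct_map_mulVec {V : Matrix ι ι ℝ} (hV : V.IsSymm) (ψ : ι → ℂ) :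
    star ψ ⬝ᵥ (V.map Complex.ofReal *ᵥ ψ) =
      (((fun i => (ψ i).re) ⬝ᵥ (V *ᵥ fun i => (ψ i).re) +
        (fun i => (ψ i).im) ⬝ᵥ (V *ᵥ fun i => (ψ i).im) : ℝ) : ℂ) := by
  apply Complex.ext
  · simp only [dotProduct, Matrix.mulVec, Matrix.map_apply, Pi.star_apply, Complex.star_def,
      Complex.re_sum, Complex.mul_re, Complex.conj_re, Complex.conj_im, Complex.im_sum,
      Complex.mul_im, Complex.ofReal_re, Complex.ofReal_im, zero_mul, sub_zero, add_zero]
    rw [← Finset.sum_add_distrib]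
    exact Finset.sum_congr rfl fun i _ => by ring
  · have hsymm : ∑ i, ∑ j, (ψ i).re * (V i j * (ψ j).im) =
        ∑ i, ∑ j, (ψ i).im * (V i j * (ψ j).re) := by
      rw [Finset.sum_comm]
      refine Finset.sum_congr rfl fun i _ => Finset.sum_congr rfl fun j _ => ?_
      rw [hV.apply i j]
      ring
    simp only [dotProduct, Matrix.mulVec, Matrix.map_apply, Pi.star_apply, Complex.star_def,
      Complex.mul_re, Complex.mul_im, Complex.conj_re, Complex.conj_im, Complex.im_sum,
      Complex.ofReal_re, Complex.ofReal_im, zero_mul, sub_zero, add_zero,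
      Finset.mul_sum,
      Finset.sum_add_distrib, neg_mul, Finset.sum_neg_distrib]
    rw [hsymm]
    ring

theorem trace_realPart_mul {V : Matrix ι ι ℝ} (hV : V.IsSymm) (ψ : ι → ℂ) :
    star ψ ⬝ᵥ (V.map Complex.ofReal *ᵥ ψ) = (((realPart ψ * V).trace : ℝ) : ℂ) := by
  rw [star_dotProduct_map_mulVec hV, realPart_eq, Matrix.add_mul, Matrix.trace_add,
    Matrix.vecMulVec_mul, Matrix.vecMulVec_mul, Matrix.trace_vecMulVec, Matrix.trace_vecMulVec]
  simp only [← Matrix.mulVec_transpose, hV.eq]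

end RealForms

/-- The fidelity vector of a real vector of a block that need not be normalized: homogeneous of
degree two, so that it adds up over the components of a state. -/
noncomputable def blockForm {N : ℕ} (μ : YoungDiagram) (φ : StdTableau (N + 1) μ → ℝ) :
    Fin N → ℝ :=
  fun k => 1 / 2 * ∑ T, φ T ^ 2 - 1 / 2 * (φ ⬝ᵥ (swapMatrix μ k *ᵥ φ))

theorem blockFidelity_eq {N : ℕ} (μ : YoungDiagram) (ψ : StdTableau (N + 1) μ → ℂ)
    (hψ : ∑ T, ‖ψ T‖ ^ 2 = 1) :
    blockFidelity μ ψ = blockForm μ (fun T => (ψ T).re) + blockForm μ (fun T => (ψ T).im) := by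
  funext k
  have h := sum_norm_sq_eq ψ
  rw [hψ] at h
  simp only [blockFidelity, star_dotProduct_map_mulVec (swapMatrix_isSymm μ k), Pi.add_apply,
    blockForm, Complex.ofReal_re]
  linear_combination (1 / 2 : ℝ) * h

theorem blockForm_zero {N : ℕ} (μ : YoungDiagram) :
    blockForm μ (0 : StdTableau (N + 1) μ → ℝ) = 0 := by
  funext k
  simp [blockForm]

theorem blockForm_mem_realBlockRegion {N : ℕ} (μ : YoungDiagram) (φ : StdTableau (N + 1) μ → ℝ)
    (hφ : ∑ T, φ T ^ 2 = 1) : blockForm μ φ ∈ realBlockRegion N μ := by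
  have h1 : ∑ T, ‖((φ T : ℝ) : ℂ)‖ ^ 2 = 1 := by
    simpa using hφ
  refine ⟨fun T => (φ T : ℂ), h1, fun T => Complex.ofReal_im _, ?_⟩
  rw [blockFidelity_eq μ _ h1]
  simp only [Complex.ofReal_re, Complex.ofReal_im]
  rw [show (fun _ : StdTableau (N + 1) μ => (0 : ℝ)) = 0 from rfl, blockForm_zero, add_zero]

theorem inv_smul_blockForm_mem_realBlockRegion {N : ℕ} (μ : YoungDiagram)
    (φ : StdTableau (N + 1) μ → ℝ) (hφ : ∑ T, φ T ^ 2 ≠ 0) :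
    (∑ T, φ T ^ 2)⁻¹ • blockForm μ φ ∈ realBlockRegion N μ := by
  have h0 : 0 ≤ ∑ T, φ T ^ 2 := Finset.sum_nonneg fun T _ => sq_nonneg _
  have hs : ((Real.sqrt (∑ T, φ T ^ 2))⁻¹) ^ 2 = (∑ T, φ T ^ 2)⁻¹ := by
    rw [inv_pow, Real.sq_sqrt h0]
  have h1 : ∑ T, ((Real.sqrt (∑ T, φ T ^ 2))⁻¹ • φ) T ^ 2 = 1 := by
    simp only [Pi.smul_apply, smul_eq_mul, mul_pow, hs, ← Finset.mul_sum]
    exact inv_mul_cancel₀ hφ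
  convert blockForm_mem_realBlockRegion μ _ h1 using 1
  funext k
  rw [Pi.smul_apply]
  unfold blockForm
  rw [h1]
  simp only [Matrix.mulVec_smul, dotProduct_smul, smul_dotProduct, smul_eq_mul]
  rw [← mul_assoc (Real.sqrt _)⁻¹, ← pow_two, hs]
  field_simp

/-- Mixtures of (unnormalized) real block vectors of total weight `1` lie in the convex hull of the
real block regions involved. -/
theorem sum_blockForm_mem_convexHull {N : ℕ} {κ : Type*} [Fintype κ] {R : Set (Fin N → ℝ)}
    (μ : κ → YoungDiagram) (hR : ∀ i, realBlockRegion N (μ i) ⊆ R)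
    (φ : ∀ i, StdTableau (N + 1) (μ i) → ℝ) (hφ : ∑ i, ∑ T, φ i T ^ 2 = 1) :
    ∑ i, blockForm (μ i) (φ i) ∈ convexHull ℝ R := by
  refine sum_mem_convexHull_of_weights _ (fun i => ∑ T, φ i T ^ 2)
    (fun i => Finset.sum_nonneg fun T _ => sq_nonneg _) hφ (fun i hi => ?_)
    fun i hi => hR i (inv_smul_blockForm_mem_realBlockRegion _ _ hi)
  rw [eq_zero_of_sum_sq_eq_zero hi, blockForm_zero]

theorem convexHull_blockRegion {N : ℕ} (μ : YoungDiagram) :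
    convexHull ℝ (blockRegion N μ) = convexHull ℝ (realBlockRegion N μ) := by
  apply Set.Subset.antisymm
  · refine convexHull_min ?_ (convex_convexHull ℝ _)
    rintro F ⟨ψ, hψ, rfl⟩
    let φ : Fin 2 → StdTableau (N + 1) μ → ℝ := ![fun T => (ψ T).re, fun T => (ψ T).im]
    have h : blockFidelity μ ψ = ∑ l, blockForm μ (φ l) := by
      rw [blockFidelity_eq μ ψ hψ, Fin.sum_univ_two]
      rfl
    rw [h]
    refine sum_blockForm_mem_convexHull (fun _ => μ) (fun _ => subset_rfl) φ ?_
    rw [Fin.sum_univ_two, ← hψ, sum_norm_sq_eq]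
    rfl
  · refine convexHull_mono ?_
    rintro F ⟨ψ, hψ, -, rfl⟩
    exact ⟨ψ, hψ, rfl⟩

/-! ### Clebsch–Gordan coefficients -/

/-- The Clebsch–Gordan coefficient for adding one qubit: from a two-row diagram with rows `a`, `b`
and a basis vector of its spin representation with `w` ones, to the diagram with a box added in row
`r`, when the added qubit is in state `s`. -/
noncomputable def cg (a b w : ℝ) (r s : Fin 2) : ℝ :=
  if r = 0 then
    if s = 0 then √((a + 1 - w) / (a - b + 1)) else √((w + 1 - b) / (a - b + 1))
  else if s = 0 then -√((w - b) / (a - b + 1)) else √((a - w) / (a - b + 1))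

theorem cg_col_norm {a b w : ℝ} (h1 : b ≤ w) (h2 : w ≤ a) (s : Fin 2) :
    ∑ r, cg a b w r s * cg a b w r s = 1 := by
  have hd : 0 < a - b + 1 := by linarith
  rw [Fin.sum_univ_two]
  obtain rfl | rfl : s = 0 ∨ s = 1 := by omega
  · simp only [cg, if_true, one_ne_zero, if_false, neg_mul_neg]
    rw [Real.mul_self_sqrt (by apply div_nonneg <;> linarith),
      Real.mul_self_sqrt (by apply div_nonneg <;> linarith)]
    field_simp
    ring
  · simp only [cg, if_true, one_ne_zero, if_false]
    rw [Real.mul_self_sqrt (by apply div_nonneg <;> linarith),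
      Real.mul_self_sqrt (by apply div_nonneg <;> linarith)]
    field_simp
    ring

theorem cg_col_orthogonal (a b w : ℝ) : ∑ r, cg a b (w + 1) r 0 * cg a b w r 1 = 0 := by
  rw [Fin.sum_univ_two]
  simp only [cg, if_true, one_ne_zero, if_false]
  rw [show a + 1 - (w + 1) = a - w by ring]
  ring

/-- The product of the coefficients of two successive steps, in rows `r` and `r'`, that add qubits
in the states `s` and `s'`. -/
noncomputable def cgTwo (a b w : ℝ) (r r' s s' : Fin 2) : ℝ :=
  cg a b w r s *
    cg (a + if r = 0 then 1 else 0) (b + if r = 1 then 1 else 0) (w + if s = 1 then 1 else 0) r' s'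

/-- Exchanging the two qubits added by steps in the same row changes nothing. -/
theorem cgTwo_swap_same {a b w : ℝ} (h1 : b ≤ w) (h2 : w ≤ a) (r s s' : Fin 2) :
    cgTwo a b w r r s' s = cgTwo a b w r r s s' := by
  have hd : 0 < a - b + 1 := by linarith
  have key : cgTwo a b w r r 0 1 = cgTwo a b w r r 1 0 := by
    obtain rfl | rfl : r = 0 ∨ r = 1 := by omega
    · simp only [cgTwo, cg, if_true, one_ne_zero, zero_ne_one, if_false, add_zero]
      rw [← Real.sqrt_mul (by apply div_nonneg <;> linarith),
        ← Real.sqrt_mul (by apply div_nonneg <;> linarith)]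
      congr 1
      ring
    · simp only [cgTwo, cg, if_true, one_ne_zero, zero_ne_one, if_false, add_zero, neg_mul,
        mul_neg]
      rw [← Real.sqrt_mul (by apply div_nonneg <;> linarith),
        ← Real.sqrt_mul (by apply div_nonneg <;> linarith)]
      congr 2
      ring
  obtain rfl | rfl : s = 0 ∨ s = 1 := by omega
  · obtain rfl | rfl : s' = 0 ∨ s' = 1 := by omega
    · rfl
    · exact key.symm
  · obtain rfl | rfl : s' = 0 ∨ s' = 1 := by omega
    · exact key
    · rfl

theorem sqrt_one_sub_inv_sq {d : ℝ} (hd : 1 ≤ d) :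
    √(1 - 1 / d ^ 2) = √(d - 1) * √(d + 1) / d := by
  rw [← Real.sqrt_mul (by linarith), ← Real.sqrt_sq (show 0 ≤ d by linarith),
    ← Real.sqrt_div' _ (by positivity), Real.sqrt_sq (show 0 ≤ d by linarith)]
  congr 1
  field_simp
  ring

theorem cgTwo_zero_one {a b w : ℝ} (h1 : b ≤ w) (h2 : w ≤ a) (s s' : Fin 2) :
    cgTwo a b w 0 1 s s' =
      (if s = 0 then if s' = 0 then -(√(a + 1 - w) * √(w - b)) else a + 1 - w
        else if s' = 0 then -(w + 1 - b) else √(a - w) * √(w + 1 - b)) /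
      (√(a - b + 1) * √(a - b + 1 + 1)) := by
  have e1 : a + 1 - b + 1 = a - b + 1 + 1 := by ring
  have e2 : a + 1 - (w + 1) = a - w := by ring
  obtain rfl | rfl : s = 0 ∨ s = 1 := by omega
  all_goals obtain rfl | rfl : s' = 0 ∨ s' = 1 := by omega
  all_goals
    simp only [cgTwo, cg, if_true, one_ne_zero, zero_ne_one, if_false, add_zero, e1, e2,
      Real.sqrt_div' _ (show 0 ≤ a - b + 1 by linarith),
      Real.sqrt_div' _ (show 0 ≤ a - b + 1 + 1 by linarith)]
  · ring
  · rw [div_mul_div_comm, Real.mul_self_sqrt (by linarith)]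
  · rw [mul_neg, div_mul_div_comm, Real.mul_self_sqrt (by linarith), neg_div]
  · ring

theorem cgTwo_one_zero {a b w : ℝ} (h1 : b ≤ w) (h2 : w ≤ a) (h3 : b + 1 ≤ a) (s s' : Fin 2) :
    cgTwo a b w 1 0 s s' =
      (if s = 0 then if s' = 0 then -(√(a + 1 - w) * √(w - b)) else -(w - b)
        else if s' = 0 then a - w else √(a - w) * √(w + 1 - b)) /
      (√(a - b + 1) * √(a - b + 1 - 1)) := by
  have e1 : a - (b + 1) + 1 = a - b + 1 - 1 := by ring
  have e2 : a + 1 - (w + 1) = a - w := by ring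
  have e3 : w + 1 - (b + 1) = w - b := by ring
  have e4 : w + 1 + 1 - (b + 1) = w + 1 - b := by ring
  obtain rfl | rfl : s = 0 ∨ s = 1 := by omega
  all_goals obtain rfl | rfl : s' = 0 ∨ s' = 1 := by omega
  all_goals
    simp only [cgTwo, cg, if_true, one_ne_zero, zero_ne_one, if_false, add_zero, e1, e2, e3, e4,
      Real.sqrt_div' _ (show 0 ≤ a - b + 1 by linarith),
      Real.sqrt_div' _ (show 0 ≤ a - b + 1 - 1 by linarith)]
  · ring
  · rw [neg_mul, div_mul_div_comm, Real.mul_self_sqrt (by linarith), neg_div]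
  · rw [div_mul_div_comm, Real.mul_self_sqrt (by linarith)]
  · ring

/-- Exchanging the two qubits added by a step in the first row and a step in the second: the first
mixed case of Young's orthogonal form, with axial distance `-(a - b + 1)`. -/
theorem cgTwo_swap_zero_one {a b w : ℝ} (h1 : b ≤ w) (h2 : w ≤ a) (h3 : a = b ∨ b + 1 ≤ a)
    (s s' : Fin 2) :
    cgTwo a b w 0 1 s' s = 1 / (-(a - b + 1)) * cgTwo a b w 0 1 s s' +
      √(1 - 1 / (-(a - b + 1)) ^ 2) * cgTwo a b w 1 0 s s' := by
  rw [neg_sq, sqrt_one_sub_inv_sq (by linarith)]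
  rcases h3 with h | h
  -- rows of equal length, where the second term is absent
  · obtain rfl : w = a := by linarith
    obtain rfl : b = w := by linarith
    obtain rfl | rfl : s = 0 ∨ s = 1 := by omega
    all_goals obtain rfl | rfl : s' = 0 ∨ s' = 1 := by omega
    all_goals simp [cgTwo, cg]
  have hP : 0 < √(a - b + 1 - 1) := Real.sqrt_pos.2 (by linarith)
  have hQ : 0 < √(a - b + 1) := Real.sqrt_pos.2 (by linarith)
  have hR : 0 < √(a - b + 1 + 1) := Real.sqrt_pos.2 (by linarith)
  have hR2 := Real.sq_sqrt (show 0 ≤ a - b + 1 + 1 by linarith)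
  have hd : a - b + 1 ≠ 0 := by linarith
  rw [cgTwo_zero_one h1 h2, cgTwo_zero_one h1 h2, cgTwo_one_zero h1 h2 h]
  generalize √(a - b + 1 - 1) = P at *
  generalize √(a - b + 1 + 1) = R at *
  generalize √(a - b + 1) = Q at *
  generalize √(a + 1 - w) * √(w - b) = X
  generalize √(a - w) * √(w + 1 - b) = Y
  have e : ∀ m m' m'' : ℝ, -m + R ^ 2 * m'' = (a - b + 1) * m' →
      m' / (Q * R) = 1 / (-(a - b + 1)) * (m / (Q * R)) +
        P * R / (a - b + 1) * (m'' / (Q * P)) := by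
    intro m m' m'' h
    have : m' = (-m + R ^ 2 * m'') / (a - b + 1) := by rw [h]; field_simp
    rw [this]
    field_simp
  apply e
  rw [hR2]
  obtain rfl | rfl : s = 0 ∨ s = 1 := by omega
  all_goals obtain rfl | rfl : s' = 0 ∨ s' = 1 := by omega
  all_goals
    simp only [if_true, one_ne_zero, if_false]
    ring

/-- Exchanging the two qubits added by a step in the second row and a step in the first: the second
mixed case of Young's orthogonal form, with axial distance `a - b + 1`. -/
theorem cgTwo_swap_one_zero {a b w : ℝ} (h1 : b ≤ w) (h2 : w ≤ a) (h3 : b + 1 ≤ a)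
    (s s' : Fin 2) :
    cgTwo a b w 1 0 s' s = 1 / (a - b + 1) * cgTwo a b w 1 0 s s' +
      √(1 - 1 / (a - b + 1) ^ 2) * cgTwo a b w 0 1 s s' := by
  rw [sqrt_one_sub_inv_sq (by linarith)]
  have hP : 0 < √(a - b + 1 - 1) := Real.sqrt_pos.2 (by linarith)
  have hQ : 0 < √(a - b + 1) := Real.sqrt_pos.2 (by linarith)
  have hR : 0 < √(a - b + 1 + 1) := Real.sqrt_pos.2 (by linarith)
  have hP2 := Real.sq_sqrt (show 0 ≤ a - b + 1 - 1 by linarith)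
  have hd : a - b + 1 ≠ 0 := by linarith
  rw [cgTwo_one_zero h1 h2 h3, cgTwo_one_zero h1 h2 h3, cgTwo_zero_one h1 h2]
  generalize √(a - b + 1 - 1) = P at *
  generalize √(a - b + 1 + 1) = R at *
  generalize √(a - b + 1) = Q at *
  generalize √(a + 1 - w) * √(w - b) = X
  generalize √(a - w) * √(w + 1 - b) = Y
  have e : ∀ m m' m'' : ℝ, m + P ^ 2 * m'' = (a - b + 1) * m' →
      m' / (Q * P) = 1 / (a - b + 1) * (m / (Q * P)) +
        P * R / (a - b + 1) * (m'' / (Q * R)) := by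
    intro m m' m'' h
    have : m' = (m + P ^ 2 * m'') / (a - b + 1) := by rw [h]; field_simp
    rw [this]
    field_simp
  apply e
  rw [hP2]
  obtain rfl | rfl : s = 0 ∨ s = 1 := by omega
  all_goals obtain rfl | rfl : s' = 0 ∨ s' = 1 := by omega
  all_goals
    simp only [if_true, one_ne_zero, if_false]
    ring

/-! ### The Schur basis of the qubits -/

/-- The number of letters `s` among the first `k` letters of the word `p`. -/
def cnt {n : ℕ} (p : Fin n → Fin 2) (s : Fin 2) (k : ℕ) : ℕ :=
  ∑ j : Fin n, if (j : ℕ) < k ∧ p j = s then 1 else 0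

theorem cnt_zero {n : ℕ} (p : Fin n → Fin 2) (s : Fin 2) : cnt p s 0 = 0 := by
  simp [cnt]

theorem cnt_succ {n : ℕ} (p : Fin n → Fin 2) (s : Fin 2) (i : Fin n) :
    cnt p s (i + 1) = cnt p s i + if p i = s then 1 else 0 := by
  have h : (if p i = s then 1 else 0) =
      ∑ j : Fin n, if j = i then if p i = s then 1 else 0 else 0 := by
    simp
  rw [h]
  simp only [cnt]
  rw [← Finset.sum_add_distrib]
  refine Finset.sum_congr rfl fun j _ => ?_
  by_cases hj : j = i
  · subst hj
    simp
  · have : (j : ℕ) < i + 1 ↔ (j : ℕ) < i := by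
      have := Fin.val_ne_of_ne hj
      omega
    simp [hj, this]

theorem cnt_mono {n : ℕ} (p : Fin n → Fin 2) (s : Fin 2) {k l : ℕ} (h : k ≤ l) :
    cnt p s k ≤ cnt p s l := by
  refine Finset.sum_le_sum fun j _ => ?_
  split_ifs <;> omega

theorem cnt_zero_add_cnt_one {n : ℕ} (p : Fin n → Fin 2) {k : ℕ} (hk : k ≤ n) :
    cnt p 0 k + cnt p 1 k = k := by
  induction k with
  | zero => simp [cnt_zero]
  | succ k ih =>
    have h0 := cnt_succ p 0 ⟨k, hk⟩
    have h1 := cnt_succ p 1 ⟨k, hk⟩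
    have := ih (by omega)
    obtain h | h : p ⟨k, hk⟩ = 0 ∨ p ⟨k, hk⟩ = 1 := by omega
    all_goals simp [h] at h0 h1; omega

theorem cnt_snoc {n : ℕ} (p : Fin n → Fin 2) (r s : Fin 2) {k : ℕ} (hk : k ≤ n) :
    cnt (Fin.snoc p r : Fin (n + 1) → Fin 2) s k = cnt p s k := by
  unfold cnt
  rw [Fin.sum_univ_castSucc]
  simp [Nat.not_lt.2 hk]

theorem cnt_snoc_last {n : ℕ} (p : Fin n → Fin 2) (r s : Fin 2) :
    cnt (Fin.snoc p r : Fin (n + 1) → Fin 2) s (n + 1) = cnt p s n + if r = s then 1 else 0 := by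
  have := cnt_succ (Fin.snoc p r : Fin (n + 1) → Fin 2) s (Fin.last n)
  simpa [cnt_snoc] using this

/-- Exchanging two neighbouring letters changes only the count between them. -/
theorem cnt_comp_swap {N : ℕ} (p : Fin (N + 1) → Fin 2) (s : Fin 2) (i : Fin N) {k : ℕ}
    (hk : k ≠ i + 1) : cnt (p ∘ Equiv.swap i.castSucc i.succ) s k = cnt p s k := by
  simp only [cnt]
  rw [← Equiv.sum_comp (Equiv.swap i.castSucc i.succ)]
  refine Finset.sum_congr rfl fun j _ => ?_
  have : ((Equiv.swap i.castSucc i.succ j : Fin (N + 1)) : ℕ) < k ↔ (j : ℕ) < k := by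
    rw [Equiv.swap_apply_def]
    split_ifs with h1 h2
    · subst h1; simp; omega
    · subst h2; simp; omega
    · rfl
  simp [this]

/-- The amplitude at the string `x` of the Schur basis vector whose path of two-row diagrams is
`p` (step `i` adds a box in row `p i`): the product of the Clebsch–Gordan coefficients along the
path.  The number of ones in `x` tells the vectors of the same path apart, so that a basis vector is
the restriction of `amp p` to the strings with a given number of ones. -/
noncomputable def amp {n : ℕ} (p x : Fin n → Fin 2) : ℝ :=
  ∏ i : Fin n, cg (cnt p 0 i) (cnt p 1 i) (cnt x 1 i) (p i) (x i)

theorem amp_snoc {n : ℕ} (p x : Fin n → Fin 2) (r s : Fin 2) :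
    amp (Fin.snoc p r : Fin (n + 1) → Fin 2) (Fin.snoc x s) =
      amp p x * cg (cnt p 0 n) (cnt p 1 n) (cnt x 1 n) r s := by
  simp only [amp, Fin.prod_univ_castSucc, Fin.snoc_castSucc, Fin.snoc_last, Fin.val_castSucc,
    Fin.val_last, cnt_snoc _ _ _ le_rfl]
  congr 1
  refine Finset.prod_congr rfl fun i _ => ?_
  rw [cnt_snoc _ _ _ i.2.le, cnt_snoc _ _ _ i.2.le, cnt_snoc _ _ _ i.2.le]

/-- A nonzero amplitude forces the path to stay within Young diagrams and the number of ones to stay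
within the weight range of the current spin representation: a coefficient leading out of these
ranges is zero. -/
theorem cnt_bounds_of_amp_ne_zero {n : ℕ} {p x : Fin n → Fin 2} (h : amp p x ≠ 0) {k : ℕ}
    (hk : k ≤ n) : cnt p 1 k ≤ cnt x 1 k ∧ cnt x 1 k ≤ cnt p 0 k := by
  induction k with
  | zero => simp [cnt_zero]
  | succ k ih =>
    obtain ⟨ih1, ih2⟩ := ih (by omega)
    have hf := Finset.prod_ne_zero_iff.1 h ⟨k, hk⟩ (Finset.mem_univ _)
    have e0 := cnt_succ p 0 ⟨k, hk⟩
    have e1 := cnt_succ p 1 ⟨k, hk⟩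
    have ex := cnt_succ x 1 ⟨k, hk⟩
    simp only at hf e0 e1 ex
    obtain hp | hp : p ⟨k, hk⟩ = 0 ∨ p ⟨k, hk⟩ = 1 := by omega
    all_goals obtain hx | hx : x ⟨k, hk⟩ = 0 ∨ x ⟨k, hk⟩ = 1 := by omega
    all_goals
      simp only [hp, hx, if_true, one_ne_zero, zero_ne_one, if_false, add_zero] at e0 e1 ex hf
    · omega
    · omega
    · have : cnt x 1 k ≠ cnt p 1 k := fun h => hf (by simp [cg, h])
      omega
    · have : cnt x 1 k ≠ cnt p 0 k := fun h => hf (by simp [cg, h])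
      omega

theorem sum_snoc {n : ℕ} {M : Type*} [AddCommMonoid M] (f : (Fin (n + 1) → Fin 2) → M) :
    ∑ p, f p = ∑ p : Fin n → Fin 2, ∑ r : Fin 2, f (Fin.snoc p r) := by
  rw [← Fintype.sum_prod_type',
    Fintype.sum_equiv (Fin.snocEquiv fun _ : Fin (n + 1) => Fin 2).symm _
    (fun q : Fin 2 × (Fin n → Fin 2) => f (Fin.snoc q.2 q.1))]
  · exact Fintype.sum_equiv (Equiv.prodComm _ _) _ _ fun _ => rfl
  · intro p
    simp [Fin.snocEquiv]

/-- Completeness of the Schur basis. The sum is over all words: those that are not paths of Young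
diagrams have zero amplitudes. -/
theorem sum_amp_mul_amp {n : ℕ} (x y : Fin n → Fin 2) (h : cnt x 1 n = cnt y 1 n) :
    ∑ p, amp p x * amp p y = if x = y then 1 else 0 := by
  induction n with
  | zero => simp [amp, Subsingleton.elim x y]
  | succ n ih =>
    obtain ⟨x, s, rfl⟩ : ∃ (x' : Fin n → Fin 2) (s : Fin 2), x = Fin.snoc x' s :=
      ⟨Fin.init x, x (Fin.last n), by simp⟩
    obtain ⟨y, t, rfl⟩ : ∃ (y' : Fin n → Fin 2) (t : Fin 2), y = Fin.snoc y' t :=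
      ⟨Fin.init y, y (Fin.last n), by simp⟩
    rw [cnt_snoc_last, cnt_snoc_last] at h
    rw [sum_snoc]
    simp only [amp_snoc, Fin.snoc_inj]
    have e : ∀ p : Fin n → Fin 2,
        ∑ r, amp p x * cg (cnt p 0 n) (cnt p 1 n) (cnt x 1 n) r s *
            (amp p y * cg (cnt p 0 n) (cnt p 1 n) (cnt y 1 n) r t) =
          amp p x * amp p y * ∑ r, cg (cnt p 0 n) (cnt p 1 n) (cnt x 1 n) r s *
            cg (cnt p 0 n) (cnt p 1 n) (cnt y 1 n) r t := by
      intro p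
      rw [Finset.mul_sum]
      exact Finset.sum_congr rfl fun r _ => by ring
    simp only [e]
    by_cases hst : s = t
    · subst hst
      have hxy : cnt x 1 n = cnt y 1 n := by omega
      rw [← hxy]
      simp only [and_true]
      rw [← ih x y hxy]
      refine Finset.sum_congr rfl fun p _ => ?_
      by_cases hp : amp p x = 0
      · simp [hp]
      · obtain ⟨h1, h2⟩ := cnt_bounds_of_amp_ne_zero hp le_rfl
        rw [cg_col_norm (by exact_mod_cast h1) (by exact_mod_cast h2), mul_one]
    · simp only [hst, and_false, if_false]
      refine Finset.sum_eq_zero fun p _ => ?_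
      obtain ⟨rfl, rfl⟩ | ⟨rfl, rfl⟩ : (s = 0 ∧ t = 1) ∨ (s = 1 ∧ t = 0) := by omega
      · simp only [zero_ne_one, if_false, add_zero, if_true] at h
        rw [h]
        push_cast
        rw [cg_col_orthogonal, mul_zero]
      · simp only [zero_ne_one, if_false, add_zero, if_true] at h
        rw [← h]
        push_cast
        simp only [mul_comm (cg _ _ (cnt x 1 n : ℝ) _ _)]
        rw [cg_col_orthogonal, mul_zero]

/-- A path is a ballot word if it stays within Young diagrams. -/
def Ballot {n : ℕ} (p : Fin n → Fin 2) : Prop :=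
  ∀ k ≤ n, cnt p 1 k ≤ cnt p 0 k

theorem ballot_of_amp_ne_zero {n : ℕ} {p x : Fin n → Fin 2} (h : amp p x ≠ 0) : Ballot p :=
  fun _ hk => (cnt_bounds_of_amp_ne_zero h hk).1.trans (cnt_bounds_of_amp_ne_zero h hk).2

/-- Rows of the Clebsch–Gordan matrix are orthonormal; the indicators take care of the ends of the
weight range, where only one of the two terms is present. -/
theorem cg_row_orthonormal {a b w : ℕ} (hab : b ≤ a) (r r' : Fin 2) :
    (if b ≤ w ∧ w ≤ a then cg a b w r 0 * cg a b w r' 0 else 0) +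
      (if b + 1 ≤ w ∧ w ≤ a + 1 then
        cg a b ((w : ℝ) - 1) r 1 * cg a b ((w : ℝ) - 1) r' 1 else 0) =
      if r = r' ∧ b + (if r = 1 then 1 else 0) ≤ w ∧ w ≤ a + (if r = 0 then 1 else 0)
        then 1 else 0 := by
  have hab' : (b : ℝ) ≤ a := by exact_mod_cast hab
  have hd : (a : ℝ) - b + 1 ≠ 0 := by linarith
  by_cases hout : w < b ∨ a + 1 < w
  · rw [if_neg (by omega), if_neg (by omega), if_neg (by split_ifs <;> omega), add_zero]
  have hb : (b : ℝ) ≤ w := by exact_mod_cast (by omega : b ≤ w)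
  have ha : (w : ℝ) ≤ a + 1 := by exact_mod_cast (by omega : w ≤ a + 1)
  have e1 : (w : ℝ) - 1 + 1 - b = w - b := by ring
  have e2 : (a : ℝ) - (w - 1) = a + 1 - w := by ring
  have s1 : √(((w : ℝ) - b) / (a - b + 1)) * √(((w : ℝ) - b) / (a - b + 1)) =
      (w - b) / (a - b + 1) := Real.mul_self_sqrt (by apply div_nonneg <;> linarith)
  have s2 : √((a + 1 - (w : ℝ)) / (a - b + 1)) * √((a + 1 - (w : ℝ)) / (a - b + 1)) =
      (a + 1 - w) / (a - b + 1) := Real.mul_self_sqrt (by apply div_nonneg <;> linarith)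
  obtain rfl | rfl : r = 0 ∨ r = 1 := by omega
  all_goals obtain rfl | rfl : r' = 0 ∨ r' = 1 := by omega
  all_goals
    simp only [cg, if_true, one_ne_zero, zero_ne_one, if_false, add_zero, e1, e2, s1, s2,
      neg_mul_neg, true_and, false_and]
  all_goals obtain rfl | rfl | h : w = b ∨ w = a + 1 ∨ (b + 1 ≤ w ∧ w ≤ a) := by omega
  all_goals
    split_ifs
    all_goals first
      | omega
      | (field_simp; done)
      | (field_simp; ring1)
      | (push_cast; simp; done)
      | (push_cast; field_simp; ring1)

/-- Orthonormality of the Schur basis: the vectors of the path `p` have `w` ones with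
`cnt p 1 n ≤ w ≤ cnt p 0 n`. -/
theorem sum_weight_amp_mul_amp {n : ℕ} {p : Fin n → Fin 2} (hp : Ballot p) (q : Fin n → Fin 2)
    (w : ℕ) :
    ∑ x : Fin n → Fin 2, (if cnt x 1 n = w then amp p x * amp q x else 0) =
      if p = q ∧ cnt p 1 n ≤ w ∧ w ≤ cnt p 0 n then 1 else 0 := by
  induction n generalizing w with
  | zero =>
    have : w = 0 ↔ 0 = w := eq_comm
    simp [amp, cnt_zero, Subsingleton.elim p q, this]
  | succ n ih =>
    obtain ⟨p, r, rfl⟩ : ∃ (p' : Fin n → Fin 2) (r : Fin 2), p = Fin.snoc p' r :=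
      ⟨Fin.init p, p (Fin.last n), by simp⟩
    obtain ⟨q, r', rfl⟩ : ∃ (q' : Fin n → Fin 2) (r : Fin 2), q = Fin.snoc q' r :=
      ⟨Fin.init q, q (Fin.last n), by simp⟩
    have hp' : Ballot p := fun k hk => by
      have := hp k (by omega)
      rwa [cnt_snoc _ _ _ hk, cnt_snoc _ _ _ hk] at this
    rw [sum_snoc]
    simp only [amp_snoc, Fin.snoc_inj, cnt_snoc_last, Fin.sum_univ_two, if_true, zero_ne_one,
      if_false, add_zero, Finset.sum_add_distrib]
    have e0 : ∑ x : Fin n → Fin 2, (if cnt x 1 n = w then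
          amp p x * cg (cnt p 0 n) (cnt p 1 n) (cnt x 1 n) r 0 *
            (amp q x * cg (cnt q 0 n) (cnt q 1 n) (cnt x 1 n) r' 0) else 0) =
        (if p = q ∧ cnt p 1 n ≤ w ∧ w ≤ cnt p 0 n then 1 else 0) *
          (cg (cnt p 0 n) (cnt p 1 n) w r 0 * cg (cnt q 0 n) (cnt q 1 n) w r' 0) := by
      rw [← ih hp' q w, Finset.sum_mul]
      refine Finset.sum_congr rfl fun x _ => ?_
      split_ifs with h
      · rw [h]; ring
      · simp
    have e1 : ∑ x : Fin n → Fin 2, (if cnt x 1 n + 1 = w then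
          amp p x * cg (cnt p 0 n) (cnt p 1 n) (cnt x 1 n) r 1 *
            (amp q x * cg (cnt q 0 n) (cnt q 1 n) (cnt x 1 n) r' 1) else 0) =
        (if p = q ∧ cnt p 1 n + 1 ≤ w ∧ w ≤ cnt p 0 n + 1 then 1 else 0) *
          (cg (cnt p 0 n) (cnt p 1 n) ((w : ℝ) - 1) r 1 *
            cg (cnt q 0 n) (cnt q 1 n) ((w : ℝ) - 1) r' 1) := by
      rcases w with _ | v
      · simp
      · simp only [Nat.add_le_add_iff_right, Nat.add_right_cancel_iff]
        rw [← ih hp' q v, Finset.sum_mul]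
        refine Finset.sum_congr rfl fun x _ => ?_
        split_ifs with h
        · rw [h]
          push_cast
          rw [add_sub_cancel_right]
          ring
        · simp
    rw [e0, e1]
    by_cases hpq : p = q
    · subst hpq
      simp only [true_and, ite_mul, one_mul, zero_mul]
      rw [cg_row_orthonormal (hp' n le_rfl)]
    · simp [hpq]

/-- The adjacent transpositions act on the path labels of the Schur basis by Young's orthogonal
form. -/
theorem amp_comp_swap {N : ℕ} {p : Fin (N + 1) → Fin 2} (hp : Ballot p) (i : Fin N) {ρ : ℝ}
    (hρ : ρ = if p i.castSucc = p i.succ then 1 else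
      if p i.castSucc = 0 then -((cnt p 0 i : ℝ) - cnt p 1 i + 1)
      else (cnt p 0 i : ℝ) - cnt p 1 i + 1) (x : Fin (N + 1) → Fin 2) :
    amp p (x ∘ Equiv.swap i.castSucc i.succ) =
      1 / ρ * amp p x + √(1 - 1 / ρ ^ 2) * amp (p ∘ Equiv.swap i.castSucc i.succ) x := by
  set τ := Equiv.swap i.castSucc i.succ with hτ
  have hne : i.castSucc ≠ i.succ := (Fin.castSucc_lt_succ (i := i)).ne
  -- all factors except those of the two exchanged letters agree
  let rest : (Fin (N + 1) → Fin 2) → (Fin (N + 1) → Fin 2) → ℝ := fun p x =>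
    ∏ j ∈ ({i.castSucc, i.succ} : Finset (Fin (N + 1)))ᶜ,
      cg (cnt p 0 j) (cnt p 1 j) (cnt x 1 j) (p j) (x j)
  have hsplit : ∀ p x : Fin (N + 1) → Fin 2, amp p x =
      cgTwo (cnt p 0 i) (cnt p 1 i) (cnt x 1 i) (p i.castSucc) (p i.succ) (x i.castSucc)
        (x i.succ) * rest p x := by
    intro p x
    have e0 := cnt_succ p 0 i.castSucc
    have e1 := cnt_succ p 1 i.castSucc
    have ex := cnt_succ x 1 i.castSucc
    simp only [Fin.val_castSucc] at e0 e1 ex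
    unfold amp
    rw [← Finset.prod_mul_prod_compl {i.castSucc, i.succ}, Finset.prod_pair hne]
    congr 1
    simp only [Fin.val_castSucc, Fin.val_succ, e0, e1, ex, cgTwo]
    push_cast
    rfl
  have hfix : ∀ j : Fin (N + 1), j ≠ i.castSucc → j ≠ i.succ → τ j = j := fun j h1 h2 =>
    Equiv.swap_apply_of_ne_of_ne h1 h2
  have hj : ∀ j : Fin (N + 1), j ≠ i.succ → (j : ℕ) ≠ i + 1 := fun j h h' =>
    h (Fin.ext (by simpa using h'))
  have hrestx : ∀ p x : Fin (N + 1) → Fin 2, rest p (x ∘ τ) = rest p x := by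
    intro p x
    refine Finset.prod_congr rfl fun j hm => ?_
    simp only [Finset.mem_compl, Finset.mem_insert, Finset.mem_singleton, not_or] at hm
    rw [hτ, cnt_comp_swap _ _ _ (hj j hm.2), ← hτ, Function.comp_apply, hfix j hm.1 hm.2]
  have hrestp : rest (p ∘ τ) x = rest p x := by
    refine Finset.prod_congr rfl fun j hm => ?_
    simp only [Finset.mem_compl, Finset.mem_insert, Finset.mem_singleton, not_or] at hm
    rw [hτ, cnt_comp_swap _ _ _ (hj j hm.2), cnt_comp_swap _ _ _ (hj j hm.2), ← hτ,
      Function.comp_apply, hfix j hm.1 hm.2]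
  have hi : (i : ℕ) ≠ i + 1 := by omega
  by_cases hr : cnt p 1 i ≤ cnt x 1 i ∧ cnt x 1 i ≤ cnt p 0 i
  swap
  -- outside the weight range all amplitudes vanish
  · have hz : ∀ p' x' : Fin (N + 1) → Fin 2, (∀ s, cnt p' s i = cnt p s i) →
        cnt x' 1 i = cnt x 1 i → amp p' x' = 0 := by
      intro p' x' h1 h2
      by_contra h
      have := cnt_bounds_of_amp_ne_zero h (k := i) (by omega)
      rw [h1, h1, h2] at this
      exact hr this
    rw [hz p _ (fun _ => rfl) (cnt_comp_swap _ _ _ hi), hz p x (fun _ => rfl) rfl,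
      hz (p ∘ τ) x (fun s => cnt_comp_swap _ _ _ hi) rfl]
    simp
  have h1 : (cnt p 1 i : ℝ) ≤ cnt x 1 i := by exact_mod_cast hr.1
  have h2 : (cnt x 1 i : ℝ) ≤ cnt p 0 i := by exact_mod_cast hr.2
  rw [hsplit p, hsplit p, hsplit (p ∘ τ), hrestx, hrestp]
  simp only [hτ, cnt_comp_swap _ _ _ hi, Function.comp_apply, Equiv.swap_apply_left,
    Equiv.swap_apply_right]
  by_cases hs : p i.castSucc = p i.succ
  · rw [if_pos hs] at hρ
    rw [hρ, hs, cgTwo_swap_same h1 h2]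
    simp
  rw [if_neg hs] at hρ
  obtain ⟨e, e'⟩ | ⟨e, e'⟩ :
      (p i.castSucc = 0 ∧ p i.succ = 1) ∨ (p i.castSucc = 1 ∧ p i.succ = 0) := by omega
  · rw [if_pos e] at hρ
    have h3 : (cnt p 0 i : ℝ) = cnt p 1 i ∨ (cnt p 1 i : ℝ) + 1 ≤ cnt p 0 i := by
      exact_mod_cast (by omega : cnt p 0 i = cnt p 1 i ∨ cnt p 1 i + 1 ≤ cnt p 0 i)
    rw [hρ, e, e', cgTwo_swap_zero_one h1 h2 h3]
    ring
  · rw [if_neg (by rw [e]; exact one_ne_zero)] at hρ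
    have h3 : (cnt p 1 i : ℝ) + 1 ≤ cnt p 0 i := by
      have e0 := cnt_succ p 0 i.castSucc
      have e1 := cnt_succ p 1 i.castSucc
      have hb := hp (i + 1) (by omega)
      simp only [Fin.val_castSucc, e, if_true, one_ne_zero, if_false] at e0 e1
      exact_mod_cast (by omega : cnt p 1 i + 1 ≤ cnt p 0 i)
    rw [hρ, e, e', cgTwo_swap_one_zero h1 h2 h3]
    ring

/-! ### Two-row tableaux as ballot words -/

section TwoRows

variable {n : ℕ} {μ : YoungDiagram}

/-- The word of a tableau with at most two rows: its `i`-th letter is the row of the entry `i`. -/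
def word (T : StdTableau n μ) : Fin n → Fin 2 :=
  fun i => if (T.1 i : ℕ × ℕ).1 = 0 then 0 else 1

theorem word_val (hμ : ∀ c ∈ μ, c.1 < 2) (T : StdTableau n μ) (i : Fin n) :
    (word T i : ℕ) = (T.1 i : ℕ × ℕ).1 := by
  have := hμ _ (T.1 i).2
  unfold word
  split_ifs with h
  · simp [h]
  · simp only [Fin.val_one]
    omega

/-- The entry in a cell of the diagram that lies weakly to the upper left of the entry `i`. -/
theorem exists_le_of_le (T : StdTableau n μ) {i : Fin n} {c : ℕ × ℕ}
    (h : c ≤ (T.1 i : ℕ × ℕ)) : ∃ j ≤ i, (T.1 j : ℕ × ℕ) = c := by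
  have hc : c ∈ μ.cells := μ.isLowerSet h (T.1 i).2
  refine ⟨T.1.symm ⟨c, hc⟩, T.2 _ _ ?_, ?_⟩
  all_goals simp [h]

theorem cnt_eq_card (p : Fin n → Fin 2) (s : Fin 2) (k : ℕ) :
    cnt p s k = (Finset.univ.filter fun j : Fin n => (j : ℕ) < k ∧ p j = s).card := by
  rw [Finset.card_filter, cnt]

/-- The word determines the tableau: the column of an entry is the number of earlier entries in its
row. -/
theorem col_eq_cnt (hμ : ∀ c ∈ μ, c.1 < 2) (T : StdTableau n μ) (i : Fin n) :
    (T.1 i : ℕ × ℕ).2 = cnt (word T) (word T i) i := by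
  have hw : ∀ j, word T j = word T i ↔ (T.1 j : ℕ × ℕ).1 = (T.1 i : ℕ × ℕ).1 := fun j => by
    rw [← word_val hμ, ← word_val hμ, Fin.val_inj]
  rw [cnt_eq_card, ← Finset.card_range (T.1 i : ℕ × ℕ).2]
  symm
  refine Finset.card_bij (fun j _ => (T.1 j : ℕ × ℕ).2) ?_ ?_ ?_
  · intro j hj
    simp only [Finset.mem_filter, Finset.mem_univ, true_and, hw] at hj
    rw [Finset.mem_range]
    by_contra h
    have := T.2 i j (Prod.mk_le_mk.2 ⟨hj.2.ge, not_lt.1 h⟩)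
    omega
  · intro j hj j' hj' h
    simp only [Finset.mem_filter, Finset.mem_univ, true_and, hw] at hj hj'
    exact T.1.injective (Subtype.ext (Prod.ext (hj.2.trans hj'.2.symm) h))
  · intro c hc
    rw [Finset.mem_range] at hc
    obtain ⟨j, hj, hj'⟩ := exists_le_of_le T (i := i) (c := ((T.1 i : ℕ × ℕ).1, c))
      (Prod.mk_le_mk.2 ⟨le_rfl, hc.le⟩)
    refine ⟨j, ?_, by rw [hj']⟩
    simp only [Finset.mem_filter, Finset.mem_univ, true_and, hw, hj', and_true]
    refine lt_of_le_of_ne hj fun h => ?_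
    rw [Fin.ext h] at hj'
    rw [hj'] at hc
    exact lt_irrefl _ hc

theorem ballot_word (hμ : ∀ c ∈ μ, c.1 < 2) (T : StdTableau n μ) : Ballot (word T) := by
  intro k _
  rw [cnt_eq_card, cnt_eq_card]
  -- the entry at the top of the column of `j`
  have hex : ∀ j, ∃ j' ≤ j, (T.1 j' : ℕ × ℕ) = (0, (T.1 j : ℕ × ℕ).2) := fun j =>
    exists_le_of_le T (Prod.mk_le_mk.2 ⟨Nat.zero_le _, le_rfl⟩)
  choose f hf hf' using hex
  refine Finset.card_le_card_of_injOn f ?_ ?_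
  · intro j hj
    simp only [Finset.coe_filter, Finset.mem_univ, true_and, Set.mem_ofPred_eq] at hj ⊢
    refine ⟨lt_of_le_of_lt (hf j) hj.1, ?_⟩
    simp [word, hf']
  · intro j hj j' hj' h
    simp only [Finset.coe_filter, Finset.mem_univ, true_and, Set.mem_ofPred_eq] at hj hj'
    have h1 := hf' j
    rw [h, hf' j'] at h1
    have h2 : (T.1 j : ℕ × ℕ).1 = (T.1 j' : ℕ × ℕ).1 := by
      rw [← word_val hμ, ← word_val hμ, hj.2, hj'.2]
    exact T.1.injective (Subtype.ext (Prod.ext h2 (Prod.ext_iff.1 h1).2.symm))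

theorem cell_eq_of_word_eq {μ' : YoungDiagram} (hμ : ∀ c ∈ μ, c.1 < 2) (hμ' : ∀ c ∈ μ', c.1 < 2)
    {T : StdTableau n μ} {T' : StdTableau n μ'} (h : word T = word T') (i : Fin n) :
    (T.1 i : ℕ × ℕ) = (T'.1 i : ℕ × ℕ) := by
  refine Prod.ext ?_ ?_
  · rw [← word_val hμ, ← word_val hμ', h]
  · rw [col_eq_cnt hμ, col_eq_cnt hμ', h]

theorem word_injective (hμ : ∀ c ∈ μ, c.1 < 2) :
    Function.Injective (word : StdTableau n μ → Fin n → Fin 2) := fun _ _ h =>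
  Subtype.ext (Equiv.ext fun i => Subtype.ext (cell_eq_of_word_eq hμ hμ h i))

end TwoRows

section Action

variable {N : ℕ} {μ : YoungDiagram}

theorem axialDist_eq (hμ : ∀ c ∈ μ, c.1 < 2) (T : StdTableau (N + 1) μ) (i : Fin N) :
    axialDist T i = if word T i.castSucc = word T i.succ then 1 else
      if word T i.castSucc = 0 then -((cnt (word T) 0 i : ℤ) - cnt (word T) 1 i + 1)
      else (cnt (word T) 0 i : ℤ) - cnt (word T) 1 i + 1 := by
  have e0 := cnt_succ (word T) 0 i.castSucc
  have e1 := cnt_succ (word T) 1 i.castSucc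
  rw [axialDist, content, content, ← word_val hμ, ← word_val hμ, col_eq_cnt hμ, col_eq_cnt hμ]
  simp only [Fin.val_castSucc, Fin.val_succ] at e0 e1 ⊢
  obtain h | h : word T i.castSucc = 0 ∨ word T i.castSucc = 1 := by omega
  all_goals obtain h' | h' : word T i.succ = 0 ∨ word T i.succ = 1 := by omega
  all_goals
    simp only [h, h', if_true, one_ne_zero, zero_ne_one, if_false, Fin.val_zero,
      Fin.val_one] at e0 e1 ⊢
    simp only [e0, e1]
    push_cast
    ring

/-- Exchanging two consecutive entries reverses the order of no other pair. -/
theorem eq_of_swap_le_swap {i : Fin N} {j k : Fin (N + 1)} (hkj : k < j)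
    (h : Equiv.swap i.castSucc i.succ j ≤ Equiv.swap i.castSucc i.succ k) :
    j = i.succ ∧ k = i.castSucc := by
  have hv : ∀ j, ((Equiv.swap i.castSucc i.succ j : Fin (N + 1)) : ℕ) =
      if (j : ℕ) = i then (i : ℕ) + 1 else if (j : ℕ) = i + 1 then (i : ℕ) else j := by
    intro j
    rw [Equiv.swap_apply_def]
    simp only [Fin.ext_iff, Fin.val_castSucc, Fin.val_succ]
    split_ifs <;> simp
  rw [Fin.le_def, hv, hv] at h
  rw [Fin.lt_def] at hkj
  simp only [Fin.ext_iff, Fin.val_castSucc, Fin.val_succ]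
  split_ifs at h <;> omega

/-- If exchanging two consecutive entries does not give a standard tableau, they are neighbours in
a row or a column, and the second term of Young's orthogonal form vanishes. -/
theorem sqrt_eq_zero_of_not_standard (hμ : ∀ c ∈ μ, c.1 < 2) (T : StdTableau (N + 1) μ)
    (i : Fin N) (h : ¬ ∃ S : StdTableau (N + 1) μ, S.1 = (Equiv.swap i.castSucc i.succ).trans T.1) :
    √(1 - 1 / (axialDist T i : ℝ) ^ 2) = 0 := by
  have hle : (T.1 i.castSucc : ℕ × ℕ) ≤ (T.1 i.succ : ℕ × ℕ) := by
    by_contra hle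
    refine h ⟨⟨(Equiv.swap i.castSucc i.succ).trans T.1, fun j k hjk => ?_⟩, rfl⟩
    simp only [Equiv.trans_apply] at hjk
    have := T.2 _ _ hjk
    by_contra hlt
    obtain ⟨rfl, rfl⟩ := eq_of_swap_le_swap (not_le.1 hlt) this
    rw [Equiv.swap_apply_left, Equiv.swap_apply_right] at hjk
    exact hle hjk
  suffices (axialDist T i : ℝ) ^ 2 = 1 by rw [this]; simp
  rw [Prod.le_def, ← word_val hμ, ← word_val hμ, col_eq_cnt hμ, col_eq_cnt hμ] at hle
  have e1 := cnt_succ (word T) 1 i.castSucc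
  have hb := ballot_word hμ T i (by omega)
  rw [axialDist_eq hμ]
  simp only [Fin.val_castSucc, Fin.val_succ] at e1 hle
  by_cases hs : word T i.castSucc = word T i.succ
  · simp [hs]
  obtain ⟨h, h'⟩ | ⟨h, h'⟩ : (word T i.castSucc = 0 ∧ word T i.succ = 1) ∨
      (word T i.castSucc = 1 ∧ word T i.succ = 0) := by omega
  · simp only [h, h', zero_ne_one, if_false, add_zero] at e1 hle
    have : cnt (word T) 0 i = cnt (word T) 1 i := by omega
    simp [h, h', this]
  · simp [h, h'] at hle

/-- The amplitudes of the tableaux of shape `μ` intertwine the permutation `σ` of the qubits with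
the matrix `M` on the block `μ`. -/
def Intertwines (μ : YoungDiagram) (σ : Equiv.Perm (Fin (N + 1)))
    (M : Matrix (StdTableau (N + 1) μ) (StdTableau (N + 1) μ) ℝ) : Prop :=
  ∀ T x, amp (word T) (x ∘ σ) = ∑ S, amp (word S) x * M S T

theorem Intertwines.one : Intertwines (N := N) μ 1 1 := by
  intro T x
  simp [Matrix.one_apply]

theorem Intertwines.mul {σ τ : Equiv.Perm (Fin (N + 1))}
    {A B : Matrix (StdTableau (N + 1) μ) (StdTableau (N + 1) μ) ℝ} (hσ : Intertwines μ σ A)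
    (hτ : Intertwines μ τ B) : Intertwines μ (σ * τ) (A * B) := by
  intro T x
  rw [Equiv.Perm.coe_mul, ← Function.comp_assoc, hτ]
  simp only [hσ _ x, Matrix.mul_apply, Finset.mul_sum, Finset.sum_mul]
  rw [Finset.sum_comm]
  exact Finset.sum_congr rfl fun S _ => Finset.sum_congr rfl fun R _ => by ring

theorem Intertwines.list_prod {f : Fin N → Equiv.Perm (Fin (N + 1))}
    {A : Fin N → Matrix (StdTableau (N + 1) μ) (StdTableau (N + 1) μ) ℝ}
    (h : ∀ i, Intertwines μ (f i) (A i)) (w : List (Fin N)) :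
    Intertwines μ (w.map f).prod (w.map A).prod := by
  induction w with
  | nil => exact Intertwines.one
  | cons i w ih =>
    rw [List.map_cons, List.map_cons, List.prod_cons, List.prod_cons]
    exact (h i).mul ih

theorem intertwines_youngAdj (hμ : ∀ c ∈ μ, c.1 < 2) (i : Fin N) :
    Intertwines μ (Equiv.swap i.castSucc i.succ) (youngAdj μ i) := by
  intro T x
  have hne : i.castSucc ≠ i.succ := (Fin.castSucc_lt_succ (i := i)).ne
  have hρ : (axialDist T i : ℝ) = if word T i.castSucc = word T i.succ then 1 else
      if word T i.castSucc = 0 then -((cnt (word T) 0 i : ℝ) - cnt (word T) 1 i + 1)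
      else (cnt (word T) 0 i : ℝ) - cnt (word T) 1 i + 1 := by
    rw [axialDist_eq hμ]
    push_cast
    rfl
  rw [amp_comp_swap (ballot_word hμ T) i hρ]
  have hterm : ∀ S : StdTableau (N + 1) μ, amp (word S) x * youngAdj μ i S T =
      (if S = T then 1 / (axialDist T i : ℝ) * amp (word T) x else 0) +
      if S.1 = (Equiv.swap i.castSucc i.succ).trans T.1 then
        √(1 - 1 / (axialDist T i : ℝ) ^ 2) * amp (word T ∘ Equiv.swap i.castSucc i.succ) x
      else 0 := by
    intro S
    by_cases hS : S = T
    · subst hS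
      have : ¬ S.1 = (Equiv.swap i.castSucc i.succ).trans S.1 := fun h => by
        have := congrArg (fun e => e i.castSucc) h
        simp only [Equiv.trans_apply, Equiv.swap_apply_left] at this
        exact hne (S.1.injective this)
      simp only [youngAdj, if_true, if_neg this, add_zero]
      ring
    · by_cases hS' : S.1 = (Equiv.swap i.castSucc i.succ).trans T.1
      · have hw : word S = word T ∘ Equiv.swap i.castSucc i.succ := by
          funext j
          simp [word, hS']
        simp only [youngAdj, if_neg hS, if_pos hS', hw]
        ring
      · simp [youngAdj, hS, hS']
  simp only [hterm, Finset.sum_add_distrib, Finset.sum_ite_eq', Finset.mem_univ, if_true]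
  congr 1
  by_cases h : ∃ S : StdTableau (N + 1) μ, S.1 = (Equiv.swap i.castSucc i.succ).trans T.1
  · obtain ⟨S, hS⟩ := h
    simp only [← hS, ← Subtype.ext_iff, Finset.sum_ite_eq', Finset.mem_univ, if_true]
  · rw [sqrt_eq_zero_of_not_standard hμ T i h]
    simp

/-- The transposition exchanging `0` and `k + 1` as a product of adjacent transpositions. -/
theorem prod_adjacent_swaps (k : Fin N) :
    (((List.finRange N).take k).map fun i => Equiv.swap i.castSucc i.succ).prod *
        Equiv.swap k.castSucc k.succ *
        (((List.finRange N).take k).reverse.map fun i => Equiv.swap i.castSucc i.succ).prod =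
      Equiv.swap 0 k.succ := by
  have hrev : ∀ w : List (Fin N),
      (w.reverse.map fun i => Equiv.swap i.castSucc i.succ).prod =
        (w.map fun i => Equiv.swap i.castSucc i.succ).prod⁻¹ := by
    intro w
    rw [List.prod_inv_reverse, List.map_reverse, List.map_map]
    simp [Function.comp_def]
  -- the conjugating product moves `k` to `0` and fixes `k + 1`
  have hW : ∀ m (hm : m < N + 1),
      (((List.finRange N).take m).map fun i => Equiv.swap i.castSucc i.succ).prod ⟨m, hm⟩ = 0 ∧
      ∀ j : Fin (N + 1), m < j →
        (((List.finRange N).take m).map fun i => Equiv.swap i.castSucc i.succ).prod j = j := by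
    intro m
    induction m with
    | zero => simp
    | succ m ih =>
      intro hm
      obtain ⟨ih0, ih1⟩ := ih (by omega)
      have ht : (List.finRange N).take (m + 1) =
          (List.finRange N).take m ++ [⟨m, by omega⟩] := by
        rw [List.take_add_one, List.getElem?_eq_getElem (by simpa using (by omega : m < N))]
        simp
      rw [ht, List.map_append, List.prod_append]
      simp only [List.map_cons, List.map_nil, List.prod_cons, List.prod_nil, mul_one,
        Equiv.Perm.mul_apply]
      refine ⟨?_, fun j hj => ?_⟩
      · rw [show (⟨m + 1, hm⟩ : Fin (N + 1)) = (⟨m, by omega⟩ : Fin N).succ from rfl,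
          Equiv.swap_apply_right]
        exact ih0
      · rw [Equiv.swap_apply_of_ne_of_ne (by simp [Fin.ext_iff]; omega)
          (by simp [Fin.ext_iff]; omega)]
        exact ih1 j (by omega)
  obtain ⟨h0, h1⟩ := hW k (by omega)
  rw [hrev, ← Equiv.swap_apply_apply, h1 k.succ (by simp)]
  congr 1

theorem intertwines_swapMatrix (hμ : ∀ c ∈ μ, c.1 < 2) (k : Fin N) :
    Intertwines μ (Equiv.swap 0 k.succ) (swapMatrix μ k) := by
  rw [← prod_adjacent_swaps k]
  exact ((Intertwines.list_prod (intertwines_youngAdj hμ) _).mul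
    (intertwines_youngAdj hμ k)).mul (Intertwines.list_prod (intertwines_youngAdj hμ) _)

end Action

/-- The Young diagram with rows of lengths `a` and `b`, meant for `b ≤ a` (otherwise the second row
is cut off at length `a`). -/
def twoRow (a b : ℕ) : YoungDiagram where
  cells := (Finset.range 2 ×ˢ Finset.range a).filter fun c => c.1 = 0 ∨ c.2 < b
  isLowerSet := by
    rintro ⟨r, c⟩ ⟨r', c'⟩ h hc
    simp only [Finset.coe_filter, Finset.mem_product, Finset.mem_range, Set.mem_ofPred_eq,
      Prod.mk_le_mk] at h hc ⊢
    omega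

theorem mem_twoRow {a b : ℕ} {c : ℕ × ℕ} :
    c ∈ twoRow a b ↔ (c.1 < 2 ∧ c.2 < a) ∧ (c.1 = 0 ∨ c.2 < b) := by
  rw [← YoungDiagram.mem_cells]
  simp [twoRow]

theorem fst_lt_two_of_mem_twoRow {a b : ℕ} : ∀ c ∈ twoRow a b, c.1 < 2 :=
  fun _ hc => (mem_twoRow.1 hc).1.1

theorem card_twoRow {a b : ℕ} (h : b ≤ a) : (twoRow a b).card = a + b := by
  have hb : (Finset.range a).filter (fun c => c < b) = Finset.range b := by
    ext c
    simp only [Finset.mem_filter, Finset.mem_range]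
    omega
  rw [YoungDiagram.card, twoRow, Finset.card_filter, Finset.sum_product, Finset.sum_range_succ,
    Finset.sum_range_one]
  simp [hb]

/-- Every ballot word is the word of a standard tableau. -/
theorem exists_word_eq {n : ℕ} {p : Fin n → Fin 2} (hp : Ballot p) :
    ∃ T : StdTableau n (twoRow (cnt p 0 n) (cnt p 1 n)), word T = p := by
  have hlt : ∀ i, cnt p (p i) i < cnt p (p i) n := fun i => by
    have := cnt_succ p (p i) i
    have := cnt_mono p (p i) (show (i : ℕ) + 1 ≤ n from i.2)
    simp only [if_true] at *
    omega
  let f : Fin n → (twoRow (cnt p 0 n) (cnt p 1 n)).cells := fun i =>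
    ⟨((p i : ℕ), cnt p (p i) i), by
      have h := hlt i
      have hb := hp n le_rfl
      rw [YoungDiagram.mem_cells, mem_twoRow]
      obtain e | e : p i = 0 ∨ p i = 1 := by omega
      all_goals
        rw [e] at h ⊢
        simp
        omega⟩
  -- a later entry in a weakly upper left position would violate the ballot condition
  have hf : ∀ i j, (f i : ℕ × ℕ) ≤ (f j : ℕ × ℕ) → i ≤ j := by
    intro i j hij
    by_contra hlt
    rw [not_le] at hlt
    obtain ⟨h1, h2⟩ := Prod.mk_le_mk.1 hij
    have hj := cnt_succ p (p j) j
    simp only [if_true] at hj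
    have hm := cnt_mono p (p i) (show (j : ℕ) + 1 ≤ i from hlt)
    have hb := hp (j + 1) (by omega)
    obtain e | e : p i = 0 ∨ p i = 1 := by omega
    all_goals
      obtain e' | e' : p j = 0 ∨ p j = 1 := by omega
    all_goals
      rw [e, e'] at h1 h2
      rw [e] at hm
      rw [e'] at hj
      omega
  have hinj : Function.Injective f := fun i j h =>
    le_antisymm (hf i j (by rw [h])) (hf j i (by rw [h]))
  have hbij : Function.Bijective f := by
    rw [Fintype.bijective_iff_injective_and_card]
    refine ⟨hinj, ?_⟩
    rw [Fintype.card_coe, Fintype.card_fin]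
    exact (cnt_zero_add_cnt_one p le_rfl).symm.trans (card_twoRow (hp n le_rfl)).symm
  refine ⟨⟨Equiv.ofBijective f hbij, fun i j h => hf i j h⟩, ?_⟩
  funext i
  obtain e | e : p i = 0 ∨ p i = 1 := by omega
  all_goals simp [word, f, e]

/-- A sum over words that is supported on ballot words is a sum over the standard tableaux with at
most two rows. -/
theorem sum_word_eq_sum_tableau {n : ℕ} {M : Type*} [AddCommMonoid M] (f : (Fin n → Fin 2) → M)
    (hf : ∀ p, ¬ Ballot p → f p = 0) :
    ∑ p, f p = ∑ b : Fin (n / 2 + 1), ∑ T : StdTableau n (twoRow (n - b) b), f (word T) := by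
  rw [← Fintype.sum_sigma' (fun (b : Fin (n / 2 + 1)) (T : StdTableau n (twoRow (n - b) b)) =>
    f (word T))]
  symm
  refine Fintype.sum_of_injective
    (fun T : (Σ b : Fin (n / 2 + 1), StdTableau n (twoRow (n - b) b)) => word T.2) ?_ _ _ ?_
    fun _ => rfl
  · have hle : ∀ {b b' : Fin (n / 2 + 1)} (T : StdTableau n (twoRow (n - b) b))
        (T' : StdTableau n (twoRow (n - b') b')), word T = word T' → (b : ℕ) ≤ b' := by
      intro b b' T T' h
      by_contra hlt
      have hmem : (1, (b' : ℕ)) ∈ twoRow (n - b) b := by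
        rw [mem_twoRow]
        simp only [Nat.one_lt_ofNat, true_and, one_ne_zero, false_or]
        omega
      have hcell := cell_eq_of_word_eq fst_lt_two_of_mem_twoRow fst_lt_two_of_mem_twoRow h
        (T.1.symm ⟨_, hmem⟩)
      rw [Equiv.apply_symm_apply] at hcell
      have hmem' := (T'.1 (T.1.symm ⟨_, hmem⟩)).2
      rw [← hcell, YoungDiagram.mem_cells, mem_twoRow] at hmem'
      simp at hmem'
    rintro ⟨b, T⟩ ⟨b', T'⟩ h
    obtain rfl : b = b' := Fin.ext (le_antisymm (hle T T' h) (hle T' T h.symm))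
    obtain rfl : T = T' := word_injective fst_lt_two_of_mem_twoRow h
    rfl
  · intro p hp
    refine hf p fun hb => hp ?_
    have h1 := cnt_zero_add_cnt_one p le_rfl
    have h2 := hb n le_rfl
    have hex := exists_word_eq hb
    rw [show cnt p 0 n = n - cnt p 1 n by omega] at hex
    obtain ⟨T, hT⟩ := hex
    exact ⟨⟨⟨cnt p 1 n, by omega⟩, T⟩, hT⟩

/-! ### Fidelities as expectations of transpositions -/

theorem comp_eq_iff {n m : ℕ} (e : Fin m → Fin n) (x : Fin n → Fin 2) (a : Fin m → Fin 2) :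
    (∀ i, x (e i) = a i) ↔ x ∘ e = a :=
  ⟨fun h => funext h, fun h i => congrFun h i⟩

open scoped Classical in
theorem dotProduct_reduced_mulVec {n m : ℕ} (e : Fin m → Fin n)
    (ρ : Matrix (Fin n → Fin 2) (Fin n → Fin 2) ℂ) (v : (Fin m → Fin 2) → ℂ) :
    star v ⬝ᵥ (reduced e ρ *ᵥ v) =
      ∑ x, ∑ y, if ∀ j, j ∉ Set.range e → x j = y j then
        star (v (x ∘ e)) * v (y ∘ e) * ρ x y else 0 := by
  simp only [dotProduct, Matrix.mulVec, reduced, Finset.mul_sum, Finset.sum_mul, Pi.star_apply]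
  calc _ = ∑ a, ∑ x, ∑ b, ∑ y, star (v a) * ((if (∀ i, x (e i) = a i) ∧ (∀ i, y (e i) = b i) ∧
          ∀ j, j ∉ Set.range e → x j = y j then ρ x y else 0) * v b) :=
        Finset.sum_congr rfl fun a _ => Finset.sum_comm
    _ = ∑ x, ∑ a, ∑ y, ∑ b, star (v a) * ((if (∀ i, x (e i) = a i) ∧ (∀ i, y (e i) = b i) ∧
          ∀ j, j ∉ Set.range e → x j = y j then ρ x y else 0) * v b) := by
        rw [Finset.sum_comm]
        exact Finset.sum_congr rfl fun x _ => Finset.sum_congr rfl fun a _ => Finset.sum_comm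
    _ = _ := by
        refine Finset.sum_congr rfl fun x _ => ?_
        rw [Finset.sum_comm]
        refine Finset.sum_congr rfl fun y _ => ?_
        rw [Fintype.sum_eq_single (x ∘ e), Fintype.sum_eq_single (y ∘ e)]
        · simp only [Function.comp_apply, implies_true, true_and]
          split_ifs <;> ring
        · intro b hb
          rw [if_neg fun h => hb ((comp_eq_iff e y b).1 h.2.1).symm]
          simp
        · intro a ha
          refine Finset.sum_eq_zero fun b _ => ?_
          rw [if_neg fun h => ha ((comp_eq_iff e x a).1 h.1).symm]
          simp

theorem star_singlet_mul_singlet (a b c d : Fin 2) :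
    star (singlet ![a, b]) * singlet ![c, d] =
      1 / 2 * ((if a = c ∧ b = d then 1 else 0) - if c = b ∧ d = a then 1 else 0) := by
  have h : (((√2)⁻¹ : ℝ) : ℂ) * (((√2)⁻¹ : ℝ) : ℂ) = 1 / 2 := by
    rw [← Complex.ofReal_mul, ← mul_inv, Real.mul_self_sqrt (by norm_num)]
    norm_num
  have hs : ∀ a b : Fin 2, singlet ![a, b] = if a = 0 ∧ b = 1 then (((√2)⁻¹ : ℝ) : ℂ) else
      if a = 1 ∧ b = 0 then -(((√2)⁻¹ : ℝ) : ℂ) else 0 := by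
    intro a b
    simp [singlet, funext_iff, Fin.forall_fin_two]
  rw [hs, hs]
  generalize (√2)⁻¹ = t at h
  obtain rfl | rfl : a = 0 ∨ a = 1 := by omega
  all_goals obtain rfl | rfl : b = 0 ∨ b = 1 := by omega
  all_goals obtain rfl | rfl : c = 0 ∨ c = 1 := by omega
  all_goals obtain rfl | rfl : d = 0 ∨ d = 1 := by omega
  all_goals simp [h]

/-- The singlet projector is `(1 - V) / 2`, where `V` exchanges the two qubits. -/
theorem fidelity_eq {N : ℕ} (ρ : Matrix (Fin (N + 1) → Fin 2) (Fin (N + 1) → Fin 2) ℂ)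
    (k : Fin N) :
    fidelity ρ k = 1 / 2 * (∑ x, (ρ x x - ρ x (x ∘ Equiv.swap 0 k.succ))).re := by
  classical
  have h2 : ∀ z : ℂ, 1 / 2 * z.re = (1 / 2 * z).re := fun z => by simp
  rw [fidelity, dotProduct_reduced_mulVec, h2, Finset.mul_sum]
  congr 2
  funext x
  have hcomp : ∀ x : Fin (N + 1) → Fin 2, x ∘ ![0, k.succ] = ![x 0, x k.succ] := fun x => by
    funext i
    fin_cases i <;> rfl
  have hterm : ∀ y : Fin (N + 1) → Fin 2,
      (if ∀ j, j ∉ Set.range ![0, k.succ] → x j = y j then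
        star (singlet (x ∘ ![0, k.succ])) * singlet (y ∘ ![0, k.succ]) * ρ x y else 0) =
      1 / 2 * ((if y = x then ρ x y else 0) -
        if y = x ∘ Equiv.swap 0 k.succ then ρ x y else 0) := by
    intro y
    have hr : ∀ j, j ∉ Set.range ![0, k.succ] ↔ j ≠ 0 ∧ j ≠ k.succ := fun j => by
      simp [and_comm]
    have hfix : ∀ j, j ≠ 0 ∧ j ≠ k.succ → x (Equiv.swap 0 k.succ j) = x j := fun j hj => by
      rw [Equiv.swap_apply_of_ne_of_ne hj.1 hj.2]
    simp only [hr]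
    by_cases hoff : ∀ j, j ≠ 0 ∧ j ≠ k.succ → x j = y j
    · have e1 : y = x ↔ x 0 = y 0 ∧ x k.succ = y k.succ := by
        refine ⟨fun h => by simp [h], fun h => funext fun j => ?_⟩
        by_cases h0 : j = 0
        · rw [h0, h.1]
        by_cases hk : j = k.succ
        · rw [hk, h.2]
        exact (hoff j ⟨h0, hk⟩).symm
      have e2 : y = x ∘ Equiv.swap 0 k.succ ↔ y 0 = x k.succ ∧ y k.succ = x 0 := by
        refine ⟨fun h => by simp [h], fun h => funext fun j => ?_⟩
        by_cases h0 : j = 0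
        · simp [h0, h.1]
        by_cases hk : j = k.succ
        · simp [hk, h.2]
        rw [Function.comp_apply, hfix j ⟨h0, hk⟩, hoff j ⟨h0, hk⟩]
      rw [if_pos hoff, hcomp, hcomp, star_singlet_mul_singlet]
      simp only [e1, e2]
      split_ifs <;> ring
    · rw [if_neg hoff, if_neg, if_neg]
      · simp
      · rintro rfl
        exact hoff fun j hj => (hfix j hj).symm
      · rintro rfl
        exact hoff fun _ _ => rfl
  simp only [hterm, ← Finset.mul_sum, Finset.sum_sub_distrib, Finset.sum_ite_eq',
    Finset.mem_univ, if_true]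

/-! ### Decomposing a state into blocks -/

theorem cnt_comp_perm {n : ℕ} (x : Fin n → Fin 2) (s : Fin 2) (σ : Equiv.Perm (Fin n)) :
    cnt (x ∘ σ) s n = cnt x s n := by
  unfold cnt
  rw [← Equiv.sum_comp σ fun j => if (j : ℕ) < n ∧ x j = s then 1 else 0]
  simp

/-- The coefficient of the vector `u` at the Schur basis vector of path `p` and weight `w`. -/
noncomputable def schurCoeff {n : ℕ} (w : ℕ) (p : Fin n → Fin 2) (u : (Fin n → Fin 2) → ℝ) : ℝ :=
  ∑ x, if cnt x 1 n = w then amp p x * u x else 0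

theorem schurCoeff_eq_zero {n : ℕ} (w : ℕ) {p : Fin n → Fin 2} (hp : ¬ Ballot p)
    (u : (Fin n → Fin 2) → ℝ) : schurCoeff w p u = 0 := by
  refine Finset.sum_eq_zero fun x _ => ?_
  have : amp p x = 0 := by
    by_contra h
    exact hp (ballot_of_amp_ne_zero h)
  simp [this]

/-- Parseval's identity for the Schur basis. -/
theorem sum_mul_eq_sum_schurCoeff {n : ℕ} (u v : (Fin n → Fin 2) → ℝ) :
    ∑ x, u x * v x = ∑ w : Fin (n + 1), ∑ p, schurCoeff w p u * schurCoeff w p v := by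
  have hw : ∀ w : ℕ, ∑ p, schurCoeff w p u * schurCoeff w p v =
      ∑ x, if cnt x 1 n = w then u x * v x else 0 := by
    intro w
    simp only [schurCoeff, Finset.sum_mul_sum]
    rw [Finset.sum_comm]
    refine Finset.sum_congr rfl fun x _ => ?_
    rw [Finset.sum_comm]
    by_cases hx : cnt x 1 n = w
    · rw [if_pos hx, Fintype.sum_eq_single x]
      · simp only [if_pos hx]
        rw [← mul_one (u x * v x), ← (if_pos rfl : (if x = x then (1 : ℝ) else 0) = 1),
          ← sum_amp_mul_amp x x rfl, Finset.mul_sum]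
        exact Finset.sum_congr rfl fun p _ => by ring
      · intro y hy
        by_cases hyw : cnt y 1 n = w
        · simp only [if_pos hx, if_pos hyw]
          rw [← mul_zero (u x * v y), ← (if_neg hy.symm : (if x = y then (1 : ℝ) else 0) = 0),
            ← sum_amp_mul_amp x y (hx.trans hyw.symm), Finset.mul_sum]
          exact Finset.sum_congr rfl fun p _ => by ring
        · simp [hyw]
    · simp [hx]
  simp only [hw]
  rw [Finset.sum_comm]
  refine Finset.sum_congr rfl fun x _ => ?_
  have hx : cnt x 1 n < n + 1 := by
    have := cnt_zero_add_cnt_one x le_rfl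
    omega
  rw [Fintype.sum_eq_single (⟨cnt x 1 n, hx⟩ : Fin (n + 1))]
  · simp
  · intro w hne
    rw [if_neg]
    exact fun h => hne (Fin.ext h.symm)

/-- On the components in a block, exchanging two qubits acts by the block matrix. Its transpose
comes up from the intertwining relation, which makes no difference as it is symmetric. -/
theorem schurCoeff_comp_swap {N : ℕ} {μ : YoungDiagram} (hμ : ∀ c ∈ μ, c.1 < 2) (w : ℕ)
    (k : Fin N) (u : (Fin (N + 1) → Fin 2) → ℝ) (T : StdTableau (N + 1) μ) :
    schurCoeff w (word T) (fun x => u (x ∘ Equiv.swap 0 k.succ)) =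
      (swapMatrix μ k *ᵥ fun S => schurCoeff w (word S) u) T := by
  have hinv : Function.Involutive
      fun x : Fin (N + 1) → Fin 2 => x ∘ Equiv.swap 0 k.succ := fun x => by
    funext j
    simp
  have hinv' : ∀ x : Fin (N + 1) → Fin 2,
      (x ∘ Equiv.swap 0 k.succ) ∘ Equiv.swap 0 k.succ = x := hinv
  unfold schurCoeff
  rw [← Equiv.sum_comp (Function.Involutive.toPerm _ hinv)]
  simp only [Function.Involutive.coe_toPerm, hinv', cnt_comp_perm,
    intertwines_swapMatrix hμ k T, Matrix.mulVec, dotProduct, Finset.mul_sum]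
  rw [Finset.sum_comm]
  refine Finset.sum_congr rfl fun x _ => ?_
  split_ifs
  · rw [Finset.sum_mul]
    refine Finset.sum_congr rfl fun S _ => ?_
    rw [← (swapMatrix_isSymm μ k).apply S T]
    ring
  · simp

/-- A real vector of the qubits contributes to the fidelities as the sum of its components in the
two-row blocks. -/
theorem sum_blockForm_schurCoeff {N : ℕ} (u : (Fin (N + 1) → Fin 2) → ℝ) (k : Fin N) :
    1 / 2 * ∑ x, (u x * u x - u x * u (x ∘ Equiv.swap 0 k.succ)) =
      ∑ w : Fin (N + 1 + 1), ∑ b : Fin ((N + 1) / 2 + 1),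
        blockForm (twoRow (N + 1 - b) b) (fun T => schurCoeff w (word T) u) k := by
  have hsum : ∀ (w : ℕ) (v : (Fin (N + 1) → Fin 2) → ℝ),
      ∑ p, schurCoeff w p u * schurCoeff w p v = ∑ b : Fin ((N + 1) / 2 + 1),
        ∑ T : StdTableau (N + 1) (twoRow (N + 1 - b) b),
          schurCoeff w (word T) u * schurCoeff w (word T) v := fun w v =>
    sum_word_eq_sum_tableau (fun p => schurCoeff w p u * schurCoeff w p v) fun p hp => by
      rw [schurCoeff_eq_zero w hp, zero_mul]
  rw [Finset.sum_sub_distrib, sum_mul_eq_sum_schurCoeff u u,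
    sum_mul_eq_sum_schurCoeff u fun x => u (x ∘ Equiv.swap 0 k.succ)]
  simp only [hsum, schurCoeff_comp_swap fst_lt_two_of_mem_twoRow]
  simp only [blockForm, Finset.sum_sub_distrib, mul_sub, Finset.mul_sum, dotProduct, pow_two]

theorem sum_sq_schurCoeff {n : ℕ} (u : (Fin n → Fin 2) → ℝ) :
    ∑ x, u x * u x = ∑ w : Fin (n + 1), ∑ b : Fin (n / 2 + 1),
      ∑ T : StdTableau n (twoRow (n - b) b), schurCoeff w (word T) u ^ 2 := by
  rw [sum_mul_eq_sum_schurCoeff]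
  refine Finset.sum_congr rfl fun w _ => ?_
  simp only [pow_two]
  exact sum_word_eq_sum_tableau (fun p => schurCoeff w p u * schurCoeff w p u) fun p hp => by
    rw [schurCoeff_eq_zero _ hp, zero_mul]

open scoped MatrixOrder Matrix.Norms.L2Operator in
theorem exists_eq_conjTranspose_mul_self {m : Type*} [Fintype m] {A : Matrix m m ℂ}
    (hA : A.PosSemidef) : ∃ B : Matrix m m ℂ, A = Bᴴ * B := by
  classical
  exact CStarAlgebra.nonneg_iff_eq_star_mul_self.1 hA.nonneg

theorem fidelity_mem_convexHull {N : ℕ}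
    {ρ : Matrix (Fin (N + 1) → Fin 2) (Fin (N + 1) → Fin 2) ℂ} (hρ : ρ.PosSemidef)
    (htr : ρ.trace = 1) :
    fidelity ρ ∈ convexHull ℝ (⋃ μ ∈ {μ : YoungDiagram | μ.card = N + 1 ∧ ∀ c ∈ μ, c.1 < 2},
      realBlockRegion N μ) := by
  obtain ⟨B, rfl⟩ := exists_eq_conjTranspose_mul_self hρ
  -- real and imaginary parts of the rows of `B`
  let u : (Fin (N + 1) → Fin 2) × Fin 2 → (Fin (N + 1) → Fin 2) → ℝ :=
    fun i x => if i.2 = 0 then (B i.1 x).re else (B i.1 x).im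
  have hre : ∀ x y, ((Bᴴ * B) x y).re = ∑ i, u i x * u i y := by
    intro x y
    rw [Fintype.sum_prod_type, Matrix.mul_apply, Complex.re_sum]
    refine Finset.sum_congr rfl fun j _ => ?_
    simp [u, Complex.mul_re]
  have hF : fidelity (Bᴴ * B) =
      ∑ i : ((Fin (N + 1) → Fin 2) × Fin 2) × Fin (N + 1 + 1) × Fin ((N + 1) / 2 + 1),
        blockForm (twoRow (N + 1 - i.2.2) i.2.2)
          (fun T => schurCoeff i.2.1 (word T) (u i.1)) := by
    funext k
    rw [fidelity_eq, Finset.sum_apply, Fintype.sum_prod_type, Complex.re_sum]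
    simp only [Complex.sub_re, hre, ← Finset.sum_sub_distrib]
    rw [Finset.sum_comm, Finset.mul_sum]
    refine Finset.sum_congr rfl fun i _ => ?_
    rw [sum_blockForm_schurCoeff, Fintype.sum_prod_type]
  rw [hF]
  refine sum_blockForm_mem_convexHull _ (fun i => ?_) _ ?_
  · refine Set.subset_biUnion_of_mem
      (u := fun μ => realBlockRegion N μ) ⟨?_, fst_lt_two_of_mem_twoRow⟩
    rw [card_twoRow (by omega)]
    omega
  · have h := congrArg Complex.re htr
    simp only [Matrix.trace, Matrix.diag_apply, Complex.re_sum, hre, Complex.one_re] at h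
    rw [← h, Finset.sum_comm, Fintype.sum_prod_type]
    refine Finset.sum_congr rfl fun i _ => ?_
    rw [sum_sq_schurCoeff, Fintype.sum_prod_type]

/-! ### Realizing the pure states of a block -/

theorem exists_real_of_mem_realBlockRegion {N : ℕ} {μ : YoungDiagram} {F : Fin N → ℝ}
    (hF : F ∈ realBlockRegion N μ) :
    ∃ φ : StdTableau (N + 1) μ → ℝ, ∑ T, φ T ^ 2 = 1 ∧ F = blockForm μ φ := by
  obtain ⟨ψ, hψ, him, rfl⟩ := hF
  have h0 : (fun T => (ψ T).im) = 0 := funext him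
  refine ⟨fun T => (ψ T).re, ?_, ?_⟩
  · rw [← hψ, sum_norm_sq_eq]
    simp [him]
  · rw [blockFidelity_eq μ ψ hψ, h0, blockForm_zero, add_zero]

/-- The vector of the qubits with components `φ` in a copy of the block `μ`: that of the weight
`⌊n / 2⌋`, which occurs in the spin representation of every two-row diagram. -/
noncomputable def embed {n : ℕ} {μ : YoungDiagram} (φ : StdTableau n μ → ℝ)
    (x : Fin n → Fin 2) : ℝ :=
  if cnt x 1 n = n / 2 then ∑ T, φ T * amp (word T) x else 0

theorem sum_embed_mul_embed {n : ℕ} {μ : YoungDiagram} (hμ : ∀ c ∈ μ, c.1 < 2)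
    (f g : StdTableau n μ → ℝ) : ∑ x, embed f x * embed g x = f ⬝ᵥ g := by
  have hG : ∀ S T : StdTableau n μ,
      ∑ x : Fin n → Fin 2, (if cnt x 1 n = n / 2 then amp (word S) x * amp (word T) x else 0) =
        if S = T then 1 else 0 := by
    intro S T
    rw [sum_weight_amp_mul_amp (ballot_word hμ S)]
    have h1 := cnt_zero_add_cnt_one (word S) le_rfl
    have h2 := ballot_word hμ S n le_rfl
    have h3 : cnt (word S) 1 n ≤ n / 2 ∧ n / 2 ≤ cnt (word S) 0 n := by omega
    simp only [(word_injective hμ).eq_iff, h3, and_true]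
  have hx : ∀ x : Fin n → Fin 2, embed f x * embed g x = ∑ S, ∑ T, f S * g T *
      if cnt x 1 n = n / 2 then amp (word S) x * amp (word T) x else 0 := by
    intro x
    unfold embed
    split_ifs
    · rw [Finset.sum_mul_sum]
      exact Finset.sum_congr rfl fun S _ => Finset.sum_congr rfl fun T _ => by ring
    · simp
  simp only [hx]
  rw [Finset.sum_comm]
  refine Finset.sum_congr rfl fun S _ => ?_
  rw [Finset.sum_comm]
  simp only [← Finset.mul_sum, hG]
  simp

theorem embed_comp_swap {N : ℕ} {μ : YoungDiagram} (hμ : ∀ c ∈ μ, c.1 < 2) (k : Fin N)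
    (φ : StdTableau (N + 1) μ → ℝ) (x : Fin (N + 1) → Fin 2) :
    embed φ (x ∘ Equiv.swap 0 k.succ) = embed (swapMatrix μ k *ᵥ φ) x := by
  unfold embed
  rw [cnt_comp_perm]
  simp only [intertwines_swapMatrix hμ k _ x, Matrix.mulVec, dotProduct, Finset.mul_sum,
    Finset.sum_mul]
  rw [Finset.sum_comm]
  congr 1
  exact Finset.sum_congr rfl fun S _ => Finset.sum_congr rfl fun T _ => by ring

/-- Flipping all qubits. -/
def flipAll (n : ℕ) : Equiv.Perm (Fin n → Fin 2) :=
  Equiv.piCongrRight fun _ => Equiv.swap 0 1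

theorem flipAll_apply {n : ℕ} (x : Fin n → Fin 2) (j : Fin n) :
    flipAll n x j = Equiv.swap 0 1 (x j) :=
  rfl

/-- The equal mixture of the pure state `v` and the state with all qubits flipped. -/
noncomputable def flipMixture {n : ℕ} (v : (Fin n → Fin 2) → ℝ) :
    Matrix (Fin n → Fin 2) (Fin n → Fin 2) ℂ :=
  fun x y => ((1 / 2 * (v x * v y + v (flipAll n x) * v (flipAll n y)) : ℝ) : ℂ)

theorem flipMixture_posSemidef {n : ℕ} (v : (Fin n → Fin 2) → ℝ) :
    (flipMixture v).PosSemidef := by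
  have h : flipMixture v = ((1 / 2 : ℝ) : ℂ) •
      (Matrix.vecMulVec (fun x => (v x : ℂ)) (star fun x => (v x : ℂ)) +
        Matrix.vecMulVec (fun x => (v (flipAll n x) : ℂ))
          (star fun x => (v (flipAll n x) : ℂ))) := by
    ext x y
    simp [flipMixture, Matrix.vecMulVec_apply]
  rw [h]
  exact ((Matrix.posSemidef_vecMulVec_self_star _).add
    (Matrix.posSemidef_vecMulVec_self_star _)).smul (by
      rw [Complex.zero_le_real]
      norm_num)

theorem flipMixture_trace {n : ℕ} (v : (Fin n → Fin 2) → ℝ) (hv : ∑ x, v x * v x = 1) :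
    (flipMixture v).trace = 1 := by
  simp only [Matrix.trace, Matrix.diag_apply, flipMixture]
  rw [← Complex.ofReal_sum, ← Finset.mul_sum, Finset.sum_add_distrib,
    Equiv.sum_comp (flipAll n) fun x => v x * v x, hv]
  norm_num

theorem flipMixture_fidelity {N : ℕ} (v : (Fin (N + 1) → Fin 2) → ℝ) (k : Fin N) :
    fidelity (flipMixture v) k =
      1 / 2 * ∑ x, (v x * v x - v x * v (x ∘ Equiv.swap 0 k.succ)) := by
  have h1 : ∀ x : Fin (N + 1) → Fin 2, flipAll _ (x ∘ Equiv.swap 0 k.succ) =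
      flipAll _ x ∘ Equiv.swap 0 k.succ := fun _ => rfl
  have h2 := Equiv.sum_comp (flipAll (N + 1)) fun x =>
    v x * v x - v x * v (x ∘ Equiv.swap 0 k.succ)
  rw [fidelity_eq, Complex.re_sum]
  congr 1
  simp only [flipMixture, Complex.sub_re, Complex.ofReal_re, h1]
  calc _ = 1 / 2 * (∑ x, (v x * v x - v x * v (x ∘ Equiv.swap 0 k.succ)) +
        ∑ x, (v (flipAll _ x) * v (flipAll _ x) -
          v (flipAll _ x) * v (flipAll _ x ∘ Equiv.swap 0 k.succ))) := by
        rw [← Finset.sum_add_distrib, Finset.mul_sum]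
        exact Finset.sum_congr rfl fun x _ => by ring
    _ = _ := by
        rw [h2]
        ring

/-- Flipping makes the first qubit maximally mixed when `v` has a definite number of ones: there
are no coherences in it, and its two populations are exchanged by the flip. -/
theorem reduced_flipMixture {N : ℕ} (v : (Fin (N + 1) → Fin 2) → ℝ) (hv : ∑ x, v x * v x = 1)
    (w : ℕ) (hw : ∀ x, cnt x 1 (N + 1) ≠ w → v x = 0) :
    reduced ![0] (flipMixture v) =
      (1 / 2 : ℂ) • (1 : Matrix (Fin 1 → Fin 2) (Fin 1 → Fin 2) ℂ) := by
  classical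
  have hr : ∀ j : Fin (N + 1), j ∉ Set.range ![0] ↔ j ≠ 0 := fun j => by
    simp
  -- strings that differ exactly in the first qubit do not have the same number of ones
  have hoff : ∀ x y : Fin (N + 1) → Fin 2, x 0 ≠ y 0 → (∀ j, j ≠ 0 → x j = y j) →
      v x * v y = 0 := by
    intro x y h0 h
    by_contra hne
    have hx : cnt x 1 (N + 1) = w := by
      by_contra hx
      exact hne (by rw [hw x hx, zero_mul])
    have hy : cnt y 1 (N + 1) = w := by
      by_contra hy
      exact hne (by rw [hw y hy, mul_zero])
    have hc : ∀ x : Fin (N + 1) → Fin 2, cnt x 1 (N + 1) =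
        (if x 0 = 1 then 1 else 0) + ∑ j : Fin N, if x j.succ = 1 then 1 else 0 := fun x => by
      unfold cnt
      rw [Fin.sum_univ_succ]
      simp
    have hs : ∑ j : Fin N, (if x j.succ = 1 then 1 else 0) =
        ∑ j : Fin N, if y j.succ = 1 then 1 else 0 :=
      Finset.sum_congr rfl fun j _ => by rw [h _ (Fin.succ_ne_zero j)]
    rw [hc] at hx hy
    rw [hs] at hx
    split_ifs at hx hy <;> omega
  ext a b
  have hex : ∀ x y : Fin (N + 1) → Fin 2,
      ((∀ i, x (![0] i) = a i) ∧ (∀ i, y (![0] i) = b i) ∧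
        ∀ j, j ∉ Set.range ![0] → x j = y j) ↔
      x 0 = a 0 ∧ y 0 = b 0 ∧ ∀ j, j ≠ 0 → x j = y j := fun x y => by
    simp only [hr, Fin.forall_fin_one, Matrix.cons_val_fin_one]
  simp only [reduced, hex, Matrix.smul_apply, Matrix.one_apply]
  by_cases hab : a = b
  · subst hab
    have h1 : ∀ x : Fin (N + 1) → Fin 2,
        (∑ y, if x 0 = a 0 ∧ y 0 = a 0 ∧ ∀ j, j ≠ 0 → x j = y j then flipMixture v x y else 0) =
          if x 0 = a 0 then flipMixture v x x else 0 := by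
      intro x
      rw [Fintype.sum_eq_single x]
      · simp
      · intro y hy
        rw [if_neg]
        rintro ⟨hx0, hy0, h⟩
        refine hy (funext fun j => ?_)
        by_cases hj : j = 0
        · rw [hj, hx0, hy0]
        · exact (h j hj).symm
    simp only [h1]
    have h2 := Equiv.sum_comp (flipAll (N + 1)) fun x =>
      if x 0 = Equiv.swap 0 1 (a 0) then v x * v x else 0
    simp only [flipAll_apply, EmbeddingLike.apply_eq_iff_eq] at h2
    have h3 : ∀ x : Fin (N + 1) → Fin 2, (if x 0 = a 0 then flipMixture v x x else 0) =
        ((1 / 2 * ((if x 0 = a 0 then v x * v x else 0) +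
          if x 0 = a 0 then v (flipAll _ x) * v (flipAll _ x) else 0) : ℝ) : ℂ) := by
      intro x
      split_ifs
      · rfl
      · simp
    have h4 : ∑ x : Fin (N + 1) → Fin 2, (if x 0 = a 0 then v x * v x else 0) +
        ∑ x : Fin (N + 1) → Fin 2, (if x 0 = Equiv.swap 0 1 (a 0) then v x * v x else 0) = 1 := by
      rw [← hv, ← Finset.sum_add_distrib]
      refine Finset.sum_congr rfl fun x _ => ?_
      obtain e | e : a 0 = 0 ∨ a 0 = 1 := by omega
      all_goals
        obtain e' | e' : x 0 = 0 ∨ x 0 = 1 := by omega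
        all_goals simp [e, e']
    simp only [h3]
    rw [← Complex.ofReal_sum, ← Finset.mul_sum, Finset.sum_add_distrib, h2, h4]
    simp
  · have hab0 : a 0 ≠ b 0 := fun h => hab (funext fun i => by rw [Subsingleton.elim i 0, h])
    rw [if_neg hab, smul_zero]
    refine Finset.sum_eq_zero fun x _ => Finset.sum_eq_zero fun y _ => ?_
    split_ifs with h
    · obtain ⟨hx, hy, h⟩ := h
      have h0 : x 0 ≠ y 0 := by rwa [hx, hy]
      have e1 := hoff x y h0 h
      have e2 := hoff (flipAll _ x) (flipAll _ y) (fun e => h0 ((Equiv.swap 0 1).injective e))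
        fun j hj => by rw [flipAll_apply, flipAll_apply, h j hj]
      simp [flipMixture, e1, e2]
    · rfl

theorem realBlockRegion_subset_allowedRegion {N : ℕ} {μ : YoungDiagram}
    (hμ : ∀ c ∈ μ, c.1 < 2) : realBlockRegion N μ ⊆ allowedRegion N := by
  intro F hF
  obtain ⟨φ, hφ, rfl⟩ := exists_real_of_mem_realBlockRegion hF
  have hv : ∑ x, embed φ x * embed φ x = 1 := by
    rw [sum_embed_mul_embed hμ, ← hφ]
    simp only [dotProduct, pow_two]
  refine ⟨flipMixture (embed φ), flipMixture_posSemidef _, flipMixture_trace _ hv,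
    reduced_flipMixture _ hv ((N + 1) / 2) fun x hx => if_neg hx, ?_⟩
  funext k
  rw [flipMixture_fidelity, Finset.sum_sub_distrib]
  simp only [embed_comp_swap hμ, sum_embed_mul_embed hμ, blockForm]
  simp only [dotProduct, pow_two]
  ring

theorem convex_allowedRegion (N : ℕ) : Convex ℝ (allowedRegion N) := by
  rintro _ ⟨ρ, hρ, htr, hred, rfl⟩ _ ⟨ρ', hρ', htr', hred', rfl⟩ s t hs ht hst
  have hst' : (s : ℂ) + t = 1 := by exact_mod_cast hst
  refine ⟨(s : ℂ) • ρ + (t : ℂ) • ρ', ?_, ?_, ?_, ?_⟩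
  · exact (hρ.smul (Complex.zero_le_real.2 hs)).add (hρ'.smul (Complex.zero_le_real.2 ht))
  · rw [Matrix.trace_add, Matrix.trace_smul, Matrix.trace_smul, htr, htr', smul_eq_mul,
      smul_eq_mul, mul_one, mul_one, hst']
  · have hlin : reduced ![0] ((s : ℂ) • ρ + (t : ℂ) • ρ') =
        (s : ℂ) • reduced ![0] ρ + (t : ℂ) • reduced ![0] ρ' := by
      ext a b
      simp only [reduced, Matrix.add_apply, Matrix.smul_apply, smul_eq_mul, Finset.mul_sum,
        ← Finset.sum_add_distrib]
      refine Finset.sum_congr rfl fun x _ => Finset.sum_congr rfl fun y _ => ?_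
      split_ifs <;> simp
    rw [hlin, hred, hred', ← add_smul, hst', one_smul]
  · funext k
    simp only [Pi.add_apply, Pi.smul_apply, fidelity_eq, Complex.re_sum, Matrix.add_apply,
      Matrix.smul_apply, smul_eq_mul, Complex.sub_re, Complex.add_re, Complex.re_ofReal_mul,
      Finset.mul_sum, ← Finset.sum_add_distrib]
    exact Finset.sum_congr rfl fun x _ => by ring

theorem allowedRegion_eq (N : ℕ) :
    allowedRegion N =
      convexHull ℝ (⋃ μ ∈ {μ : YoungDiagram | μ.card = N + 1 ∧ ∀ c ∈ μ, c.1 < 2},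
        realBlockRegion N μ) := by
  apply Set.Subset.antisymm
  · rintro _ ⟨ρ, hρ, htr, -, rfl⟩
    exact fidelity_mem_convexHull hρ htr
  · exact convexHull_min
      (Set.iUnion₂_subset fun μ hμ => realBlockRegion_subset_allowedRegion hμ.2)
      (convex_allowedRegion N)

end QubitCloning

theorem lemma2 (N : ℕ) :
    -- the real matrices of the transpositions are symmetric, in every irreducible block
    (∀ μ : YoungDiagram, μ.card = N + 1 → ∀ k : Fin N, (QubitCloning.swapMatrix μ k).IsSymm) ∧
    -- the overlaps of a pure state depend on the real part of its density matrix only,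
    -- and this real part is positive semidefinite and a mixture of real pure states
    (∀ μ : YoungDiagram, μ.card = N + 1 →
      ∀ ψ : QubitCloning.StdTableau (N + 1) μ → ℂ, ∑ T, ‖ψ T‖ ^ 2 = 1 →
        (∀ k : Fin N,
          star ψ ⬝ᵥ ((QubitCloning.swapMatrix μ k).map Complex.ofReal *ᵥ ψ) =
            (((QubitCloning.realPart ψ * QubitCloning.swapMatrix μ k).trace : ℝ) : ℂ)) ∧
        (QubitCloning.realPart ψ).PosSemidef ∧
        QubitCloning.realPart ψ ∈
          convexHull ℝ (QubitCloning.realPureStates (QubitCloning.StdTableau (N + 1) μ))) ∧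
    -- in every block, real pure states generate the same convex hull as complex ones
    (∀ μ : YoungDiagram, μ.card = N + 1 →
      convexHull ℝ (QubitCloning.blockRegion N μ) =
        convexHull ℝ (QubitCloning.realBlockRegion N μ)) ∧
    -- the allowed region is generated by the real pure states of the blocks that occur for
    -- qubits, namely those of the diagrams with at most two rows
    QubitCloning.allowedRegion N =
      convexHull ℝ (⋃ μ ∈ {μ : YoungDiagram | μ.card = N + 1 ∧ ∀ c ∈ μ, c.1 < 2},
        QubitCloning.realBlockRegion N μ) := by
  refine ⟨fun μ _ k => QubitCloning.swapMatrix_isSymm μ k, fun μ _ ψ hψ =>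
    ⟨fun k => QubitCloning.trace_realPart_mul (QubitCloning.swapMatrix_isSymm μ k) ψ,
      QubitCloning.realPart_posSemidef ψ, QubitCloning.realPart_mem_convexHull ψ hψ⟩,
    fun μ _ => QubitCloning.convexHull_blockRegion μ, QubitCloning.allowedRegion_eq N⟩
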